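/- For every $n\in\mathbb N$ let $(w_x^+)_{x\in[n]}$ and $(w_x^-)_{x\in[n]}$ be positive weights, which may depend on $n$, with $\sum_{x\in[n]} w_x^+=\sum_{x\in[n]} w_x^-$. Assume that there are constants $M_0,M_1>1$, $M_2>0$ and $\eta\in(0,1)$, not depending on $n$, such that for every $n$ $$M_0\le w_x^+\le M_1\quad\text{for all }x\in[n],\qquad \sum_{x\in[n]}(w_x^-)^{2+\eta}\le M_2\,n .$$ Let $G$ be the Chung–Lu digraph on $[n]$: for all ordered pairs of distinct vertices $x,y\in[n]$ independently, the edge $x\to y$ is present with probability $p_{xy}=\min\{w_x^+w_y^-\frac{\log n}{n},1\}$; there are no loops. Let $\mathbb P$ be its law, let $D_x^+$ be the out-degree of $x$, and let $P$ be the transition matrix of the simple random walk on $G$, i.e. $P(x,y)=1/D_x^+$ if $x\to y$ and $P(x,y)=0$ otherwise. Then for every fixed $\delta\in(0,\eta/6)$, with $\mathbb P$-probability tending to $1$ as $n\to\infty$, there is a unique probability vector $\pi$ on $[n]$ with $\pi P=\pi$, and it satisfies $$\pi(S)\le n^{-\delta/2}\qquad\text{for all } S\subset[n]\text{ with }|S|\le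 n^{1-6\delta}.$$ -/

import Mathlib

open MeasureTheory ProbabilityTheory Filter Topology

noncomputable section

namespace ChungLu

/-- The connection probability from `x` to `y` in the Chung–Lu digraph on `n` vertices with
out-weights `wOut` and in-weights `wIn`: it is `min (wOut x * wIn y * log n / n) 1` for `x ≠ y`
(the projection on `[0, 1]` only truncates at `1`, as weights are positive), and there are no
loops. -/
def edgeProb {n : ℕ} (wOut wIn : Fin n → ℝ) (x y : Fin n) : unitInterval :=
  if x = y then 0
  else Set.projIcc (0 : ℝ) 1 zero_le_one (wOut x * wIn y * (Real.log n / n))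

/-- The law of the Chung–Lu digraph: independent edge indicators, one for every ordered pair of
vertices, the indicator of `(x, y)` being Bernoulli of parameter `edgeProb wOut wIn x y`. -/
def law {n : ℕ} (wOut wIn : Fin n → ℝ) : Measure (Fin n × Fin n → Bool) :=
  Measure.pi fun e => bernoulliMeasure true false (edgeProb wOut wIn e.1 e.2)

/-- The digraph encoded by a configuration of edge indicators. -/
def graph {n : ℕ} (ω : Fin n × Fin n → Bool) : Digraph (Fin n) where
  Adj x y := ω (x, y) = true

/-- The out-degree of a vertex. -/
def outDegree {n : ℕ} (G : Digraph (Fin n)) (x : Fin n) : ℕ :=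
  Set.ncard {y | G.Adj x y}

open Classical in
/-- The transition matrix of the simple random walk on a digraph: from `x` the walk moves to a
uniformly chosen out-neighbour of `x`. -/
def transition {n : ℕ} (G : Digraph (Fin n)) : Matrix (Fin n) (Fin n) ℝ :=
  Matrix.of fun x y => if G.Adj x y then 1 / (outDegree G x : ℝ) else 0

/-- `μ` is a stationary distribution of the simple random walk on `G`: it is a probability vector
with `μ P = μ`. -/
def IsStationary {n : ℕ} (G : Digraph (Fin n)) (μ : Fin n → ℝ) : Prop :=
  μ ∈ stdSimplex ℝ (Fin n) ∧ Matrix.vecMul μ (transition G) = μ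

/-- The event that the simple random walk has a unique stationary distribution `μ`, and that every
set `S` of at most `n ^ (1 - 6 δ)` vertices has mass `μ(S) ≤ n ^ (-δ / 2)`. -/
def smallSetsEvent (n : ℕ) (δ : ℝ) : Set (Fin n × Fin n → Bool) :=
  {ω | ∃ μ : Fin n → ℝ, IsStationary (graph ω) μ ∧
    (∀ ν : Fin n → ℝ, IsStationary (graph ω) ν → ν = μ) ∧
    ∀ S : Finset (Fin n), (S.card : ℝ) ≤ (n : ℝ) ^ (1 - 6 * δ) →
      ∑ x ∈ S, μ x ≤ (n : ℝ) ^ (-δ / 2)}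

end ChungLu

end

namespace ChungLu

/-! Let `λ_t` be the law at time `t` of the walk started from the uniform distribution. The proof
shows that `λ_t` is spread out in `ℓ²` at a time `t` of order `n^(δ/2)` up to logarithms, and that
the stationary law is very close to `λ_t`.

Spreading: `∑ z, λ_t(z)²` is the probability that two independent walks in the same environment end
at the same vertex. Revealing the rows of the transition matrix only as they are visited, each step
from a fresh vertex lands at `y` with averaged probability `O((1 + w_y⁻)/n)`, once rows of
out-degree below `c log n` are deleted. As `∑ (w_y⁻)² = O(n)`, the two trajectories meet each other
or themselves with averaged probability `O(t²/n)` (`integral_sum_sq_vecMul_pow_le`). Markov's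
inequality gives `∑ λ_t² ≤ n^(-1+2δ)`, and Cauchy–Schwarz gives `λ_t(S) ≤ n^(-2δ)` on small sets.

Mixing: since `M₀ > 1`, a Chernoff bound beats the union bound over all sets `A` of size at most `κ
n / log n`, so each has at least `c log n · |A|` out-neighbours
(`tendsto_measureReal_not_expanding`); in particular no row is deleted. After `s ~ log n / log log
n` generations, the descendants of any two vertices share linearly many vertices. Degrees are at
most `D log n`, so each common descendant is reached with probability at least `(D log n)^(-s) =
n^(-1-o(1))`, and two rows of the `s`-step kernel overlap by at least `n^(-δ/4)`
(`le_sum_min_transition_pow`). Dobrushin contraction over `n^(δ/2)` blocks of length `s` leaves an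
error at most `exp(-n^(δ/4))` and yields uniqueness (`stationary_sum_le`, `stationary_unique`).
`mem_smallSetsEvent` combines these facts deterministically. -/

/-- The law of independent Bernoulli variables with parameters `p i`. -/
noncomputable def bernoulliPi {ι : Type*} [Fintype ι] (p : ι → unitInterval) :
    Measure (ι → Bool) :=
  Measure.pi fun i => bernoulliMeasure true false (p i)

/-! ### Independent Bernoulli variables -/

section BernoulliPi

variable {ι : Type*} [Fintype ι] (p : ι → unitInterval)

instance : IsProbabilityMeasure (bernoulliPi p) := by
  unfold bernoulliPi; infer_instance

lemma integral_bernoulli_bool (q : unitInterval) (g : Bool → ℝ) :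
    ∫ b, g b ∂(bernoulliMeasure true false q) = q * g true + (1 - q) * g false := by
  rw [integral_fintype Integrable.of_finite]
  simp [Measure.real]

lemma integral_bernoulliPi_prod (g : ι → Bool → ℝ) :
    ∫ ω, ∏ i, g i (ω i) ∂(bernoulliPi p) =
      ∏ i, ((p i : ℝ) * g i true + (1 - p i) * g i false) := by
  unfold bernoulliPi
  rw [integral_fintype_prod_eq_prod]
  exact Finset.prod_congr rfl fun i _ => integral_bernoulli_bool _ _

lemma measurableSet_config (s : Set (ι → Bool)) : MeasurableSet s :=
  s.toFinite.measurableSet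

lemma integral_mono_config {f g : (ι → Bool) → ℝ} (h : ∀ ω, f ω ≤ g ω) :
    ∫ ω, f ω ∂(bernoulliPi p) ≤ ∫ ω, g ω ∂(bernoulliPi p) :=
  integral_mono Integrable.of_finite Integrable.of_finite h

lemma integral_sum_config {κ : Type*} (s : Finset κ) (f : κ → (ι → Bool) → ℝ) :
    ∫ ω, ∑ k ∈ s, f k ω ∂(bernoulliPi p) = ∑ k ∈ s, ∫ ω, f k ω ∂(bernoulliPi p) :=
  integral_finsetSum s fun _ _ => Integrable.of_finite

/-- Markov's inequality. -/
lemma measureReal_le_integral_div {f : (ι → Bool) → ℝ} (hf : ∀ ω, 0 ≤ f ω) {a : ℝ} (ha : 0 < a) :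
    (bernoulliPi p).real {ω | a ≤ f ω} ≤ (∫ ω, f ω ∂(bernoulliPi p)) / a := by
  rw [le_div_iff₀ ha, mul_comm]
  exact mul_meas_ge_le_integral_of_nonneg (ae_of_all _ hf) Integrable.of_finite a

open Classical in
lemma integral_indicator_absent (s : Finset ι) :
    ∫ ω, (if ∀ i ∈ s, ω i = false then (1 : ℝ) else 0) ∂(bernoulliPi p) =
      ∏ i ∈ s, (1 - (p i : ℝ)) := by
  have h : ∀ ω : ι → Bool, (if ∀ i ∈ s, ω i = false then (1 : ℝ) else 0) =
      ∏ i, (if i ∈ s then (if ω i = false then 1 else 0) else 1) := by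
    intro ω
    rw [Finset.prod_ite_mem, Finset.univ_inter, Finset.prod_ite_zero]
    simp
  simp_rw [h]
  rw [integral_bernoulliPi_prod p (fun i b => if i ∈ s then (if b = false then 1 else 0) else 1)]
  rw [← Finset.univ_inter s, ← Finset.prod_ite_mem]
  refine Finset.prod_congr rfl fun i _ => ?_
  by_cases hi : i ∈ s <;> simp [hi]

lemma measureReal_absent_le (s : Finset ι) :
    (bernoulliPi p).real {ω | ∀ i ∈ s, ω i = false} ≤ Real.exp (-∑ i ∈ s, (p i : ℝ)) := by
  classical
  rw [← integral_indicator_one (measurableSet_config _)]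
  have := integral_indicator_absent p s
  simp only [Set.indicator, Set.mem_ofPred_eq, Pi.one_apply]
  rw [this, ← Finset.sum_neg_distrib, Real.exp_sum]
  refine Finset.prod_le_prod (fun i _ => by linarith [(p i).2.2]) fun i _ => ?_
  linarith [Real.add_one_le_exp (-(p i : ℝ))]

open Classical in
/-- The Laplace transform of the number of disjoint blocks that contain a present edge. -/
lemma integral_pow_card_hit_le {κ : Type*} (T : Finset κ) (E : κ → Finset ι)
    (hE : ∀ a b, a ≠ b → Disjoint (E a) (E b)) {θ : ℝ} (hθ₀ : 0 ≤ θ) (hθ₁ : θ ≤ 1) :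
    ∫ ω, θ ^ (T.filter fun y => ∃ i ∈ E y, ω i = true).card ∂(bernoulliPi p) ≤
      Real.exp (-(1 - θ) * ∑ y ∈ T, (1 - Real.exp (-∑ i ∈ E y, (p i : ℝ)))) := by
  have h : ∀ ω : ι → Bool, θ ^ (T.filter fun y => ∃ i ∈ E y, ω i = true).card =
      ∑ U ∈ T.powerset, (1 - θ) ^ U.card * θ ^ (T \ U).card *
        (if ∀ i ∈ U.biUnion E, ω i = false then (1 : ℝ) else 0) := by
    intro ω
    -- A block contributes `θ` if hit and `1` otherwise, that is `(1 - θ) · 1[absent] + θ`.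
    -- Expanding the product leaves only absence events, whose probabilities are explicit.
    have h1 : θ ^ (T.filter fun y => ∃ i ∈ E y, ω i = true).card =
        ∏ y ∈ T, ((1 - θ) * (if ∀ i ∈ E y, ω i = false then (1 : ℝ) else 0) + θ) := by
      rw [← Finset.prod_const, Finset.prod_filter]
      refine Finset.prod_congr rfl fun y _ => ?_
      by_cases hy : ∃ i ∈ E y, ω i = true
      · have : ¬ ∀ i ∈ E y, ω i = false := by
          obtain ⟨i, hi, h⟩ := hy
          intro h'
          simp [h' i hi] at h
        simp [hy, this]
      · have : ∀ i ∈ E y, ω i = false := by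
          intro i hi
          by_contra h'
          exact hy ⟨i, hi, by simpa using h'⟩
        rw [if_neg hy, if_pos this]; ring
    rw [h1, Finset.prod_add]
    refine Finset.sum_congr rfl fun U _ => ?_
    rw [Finset.prod_mul_distrib, Finset.prod_const, Finset.prod_const, Finset.prod_ite_zero]
    simp only [Finset.prod_const_one, Finset.mem_biUnion, forall_exists_index, and_imp]
    have : (∀ i ∈ U, ∀ j ∈ E i, ω j = false) ↔ ∀ j, ∀ i ∈ U, j ∈ E i → ω j = false :=
      ⟨fun h j i hi hj => h i hi j hj, fun h i hi j hj => h j i hi hj⟩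
    simp only [this]; ring
  simp_rw [h]
  rw [integral_sum_config]
  simp_rw [integral_const_mul, integral_indicator_absent]
  have h2 : ∀ U ∈ T.powerset, (1 - θ) ^ U.card * θ ^ (T \ U).card *
      ∏ i ∈ U.biUnion E, (1 - (p i : ℝ)) =
      (∏ y ∈ U, (1 - θ) * ∏ i ∈ E y, (1 - (p i : ℝ))) * ∏ y ∈ T \ U, θ := by
    intro U _
    rw [Finset.prod_biUnion (fun a _ b _ hab => hE a b hab), Finset.prod_mul_distrib,
      Finset.prod_const, Finset.prod_const]
    ring
  rw [Finset.sum_congr rfl h2, ← Finset.prod_add, Finset.mul_sum, Real.exp_sum]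
  refine Finset.prod_le_prod (fun y _ => ?_) fun y _ => ?_
  · exact add_nonneg (mul_nonneg (by linarith)
      (Finset.prod_nonneg fun i _ => by linarith [(p i).2.2])) hθ₀
  · have h3 : ∏ i ∈ E y, (1 - (p i : ℝ)) ≤ Real.exp (-∑ i ∈ E y, (p i : ℝ)) := by
      rw [← Finset.sum_neg_distrib, Real.exp_sum]
      refine Finset.prod_le_prod (fun i _ => by linarith [(p i).2.2]) fun i _ => ?_
      linarith [Real.add_one_le_exp (-(p i : ℝ))]
    have h4 := Real.add_one_le_exp (-(1 - θ) * (1 - Real.exp (-∑ i ∈ E y, (p i : ℝ))))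
    have h5 := mul_le_mul_of_nonneg_left h3 (sub_nonneg.2 hθ₁)
    linarith

/-- Functions of disjoint sets of coordinates are uncorrelated. -/
lemma integral_mul_of_dependsOn (s : Finset ι) {f g : (ι → Bool) → ℝ}
    (hf : DependsOn f (s : Set ι)) (hg : DependsOn g (s : Set ι)ᶜ) :
    ∫ ω, f ω * g ω ∂(bernoulliPi p) =
      (∫ ω, f ω ∂(bernoulliPi p)) * ∫ ω, g ω ∂(bernoulliPi p) := by
  classical
  have hi : iIndepFun (fun i (ω : ι → Bool) => ω i) (bernoulliPi p) :=
    iIndepFun_pi (X := fun i b => b) (fun i => aemeasurable_id)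
  have h := hi.indepFun_finset s sᶜ disjoint_compl_right (fun i => measurable_pi_apply i)
  obtain ⟨f', hf'⟩ := dependsOn_iff_exists_comp.1 hf
  have hg2 : DependsOn g ((sᶜ : Finset ι) : Set ι) := by simpa using hg
  obtain ⟨g', hg'⟩ := dependsOn_iff_exists_comp.1 hg2
  have hfm : Measurable f' := measurable_of_finite _
  have hgm : Measurable g' := measurable_of_finite _
  have h' := h.comp hfm hgm
  have := h'.integral_mul_eq_mul_integral (measurable_of_finite _).aestronglyMeasurable
    (measurable_of_finite _).aestronglyMeasurable
  subst hf' hg'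
  exact this

end BernoulliPi

/-! ### Stationary laws and Dobrushin contraction for finite chains -/

section Stochastic

variable {V : Type*} [Fintype V]

/-- Both means are averages under the product coupling of `μ` and `ν`. -/
lemma sum_mul_sub_le_of_oscillation {μ ν : V → ℝ} (hμ : μ ∈ stdSimplex ℝ V)
    (hν : ν ∈ stdSimplex ℝ V) {f : V → ℝ} {D : ℝ} (hf : ∀ x y, f x - f y ≤ D) :
    ∑ x, μ x * f x - ∑ x, ν x * f x ≤ D := by
  have h1 : ∑ x, μ x * f x = ∑ x, ∑ y, μ x * ν y * f x := by
    refine Finset.sum_congr rfl fun x _ => ?_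
    rw [← Finset.sum_mul, ← Finset.mul_sum, hν.2, mul_one]
  have h2 : ∑ x, ν x * f x = ∑ x, ∑ y, μ x * ν y * f y := by
    rw [Finset.sum_comm]
    refine Finset.sum_congr rfl fun y _ => ?_
    rw [← Finset.sum_mul, ← Finset.sum_mul, hμ.2, one_mul]
  have h3 : D = ∑ x, ∑ y, μ x * ν y * D := by
    simp_rw [← Finset.sum_mul, ← Finset.mul_sum, hν.2, mul_one, hμ.2, one_mul]
  rw [h1, h2, h3, ← Finset.sum_sub_distrib]
  refine Finset.sum_le_sum fun x _ => ?_
  rw [← Finset.sum_sub_distrib]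
  refine Finset.sum_le_sum fun y _ => ?_
  rw [← mul_sub]
  exact mul_le_mul_of_nonneg_left (hf x y) (mul_nonneg (hμ.1 x) (hν.1 y))

lemma sum_le_sqrt_card_mul (S : Finset V) (v : V → ℝ) :
    ∑ x ∈ S, v x ≤ √(S.card * ∑ x, v x ^ 2) := by
  refine Real.le_sqrt_of_sq_le ((sq_sum_le_card_mul_sum_sq (s := S) (f := v)).trans ?_)
  exact mul_le_mul_of_nonneg_left
    (Finset.sum_le_sum_of_subset_of_nonneg (Finset.subset_univ S) fun _ _ _ => sq_nonneg _)
    (Nat.cast_nonneg _)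

variable [DecidableEq V] {M : Matrix V V ℝ}

/-- `M - 1` kills the constant vector, so it has a left null vector `v`. Then `|v| ≤ |v| M`
entrywise with equal total masses, which forces equality, and `|v|` can be normalised. -/
lemma exists_stationary [Nonempty V] (hM : M ∈ Matrix.rowStochastic ℝ V) :
    ∃ μ ∈ stdSimplex ℝ V, Matrix.vecMul μ M = μ := by
  have hdet : (M - 1).det = 0 := by
    rw [← Matrix.exists_mulVec_eq_zero_iff]
    refine ⟨1, one_ne_zero, ?_⟩
    rw [Matrix.sub_mulVec, Matrix.one_vecMul_of_mem_rowStochastic hM, Matrix.one_mulVec, sub_self]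
  obtain ⟨v, hv0, hv⟩ := Matrix.exists_vecMul_eq_zero_iff.2 hdet
  rw [Matrix.vecMul_sub, Matrix.vecMul_one, sub_eq_zero] at hv
  have hrow := Matrix.sum_row_of_mem_rowStochastic hM
  have hle : ∀ y, |v y| ≤ ∑ x, |v x| * M x y := fun y => by
    conv_lhs => rw [← hv]
    refine (Finset.abs_sum_le_sum_abs _ _).trans (Finset.sum_le_sum fun x _ => ?_)
    rw [abs_mul, abs_of_nonneg (Matrix.nonneg_of_mem_rowStochastic hM)]
  have hsum : ∑ y, ∑ x, |v x| * M x y = ∑ y, |v y| := by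
    rw [Finset.sum_comm]
    exact Finset.sum_congr rfl fun x _ => by rw [← Finset.mul_sum, hrow, mul_one]
  have heq : ∀ y, ∑ x, |v x| * M x y = |v y| := fun y =>
    ((Finset.sum_eq_sum_iff_of_le fun y _ => hle y).1 hsum.symm y (Finset.mem_univ y)).symm
  have hpos : 0 < ∑ y, |v y| := by
    obtain ⟨y, hy⟩ := Function.ne_iff.1 hv0
    exact Finset.sum_pos' (fun _ _ => abs_nonneg _) ⟨y, Finset.mem_univ _, abs_pos.2 hy⟩
  refine ⟨fun y => |v y| / ∑ z, |v z|, ⟨fun y => by positivity, ?_⟩, ?_⟩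
  · rw [← Finset.sum_div, div_self hpos.ne']
  · ext y
    rw [Matrix.vecMul, dotProduct, ← heq y, Finset.sum_div]
    exact Finset.sum_congr rfl fun x _ => by ring

/-- Dobrushin's contraction of the oscillation. -/
lemma oscillation_mulVec_le (hM : M ∈ Matrix.rowStochastic ℝ V) {α : ℝ}
    (hα : ∀ x y, α ≤ ∑ z, min (M x z) (M y z)) {f : V → ℝ} {D : ℝ} (hD : 0 ≤ D)
    (hf : ∀ x y, f x - f y ≤ D) (x y : V) :
    M.mulVec f x - M.mulVec f y ≤ (1 - α) * D := by
  have hrow := Matrix.sum_row_of_mem_rowStochastic hM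
  have : Nonempty V := ⟨x⟩
  obtain ⟨a, ha⟩ := Finite.exists_max f
  obtain ⟨b, hb⟩ := Finite.exists_min f
  -- The common part `d` of the two rows cancels in the difference; what remains of each row has
  -- mass `1 - ∑ d ≤ 1 - α`.
  set d : V → ℝ := fun z => min (M x z) (M y z) with hd
  have h1 : ∑ z, (M x z - d z) * f z ≤ ∑ z, (M x z - d z) * f a :=
    Finset.sum_le_sum fun z _ =>
      mul_le_mul_of_nonneg_left (ha z) (sub_nonneg.2 (min_le_left _ _))
  have h2 : ∑ z, (M y z - d z) * f b ≤ ∑ z, (M y z - d z) * f z :=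
    Finset.sum_le_sum fun z _ =>
      mul_le_mul_of_nonneg_left (hb z) (sub_nonneg.2 (min_le_right _ _))
  rw [← Finset.sum_mul, Finset.sum_sub_distrib, hrow] at h1 h2
  have h3 : M.mulVec f x - M.mulVec f y =
      ∑ z, (M x z - d z) * f z - ∑ z, (M y z - d z) * f z := by
    simp only [Matrix.mulVec, dotProduct]
    rw [← Finset.sum_sub_distrib, ← Finset.sum_sub_distrib]
    exact Finset.sum_congr rfl fun z _ => by ring
  have h4 : ∑ z, d z ≤ 1 := by
    rw [← hrow x]; exact Finset.sum_le_sum fun z _ => min_le_left _ _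
  have h5 : (1 - ∑ z, d z) * (f a - f b) ≤ (1 - α) * D :=
    (mul_le_mul_of_nonneg_left (hf a b) (by linarith)).trans
      (mul_le_mul_of_nonneg_right (by linarith [hα x y]) hD)
  rw [h3]; linarith

lemma oscillation_pow_mulVec_le (hM : M ∈ Matrix.rowStochastic ℝ V) {α : ℝ} (hα1 : α ≤ 1)
    (hα : ∀ x y, α ≤ ∑ z, min (M x z) (M y z)) {f : V → ℝ}
    (hf : ∀ x y, f x - f y ≤ 1) (J : ℕ) (x y : V) :
    (M ^ J).mulVec f x - (M ^ J).mulVec f y ≤ (1 - α) ^ J := by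
  induction J generalizing x y with
  | zero => simpa using hf x y
  | succ J ih =>
    rw [pow_succ', ← Matrix.mulVec_mulVec, pow_succ']
    exact oscillation_mulVec_le hM hα (pow_nonneg (by linarith) J) (fun x y => ih x y) x y

lemma vecMul_pow_of_stationary {μ : V → ℝ} (h : Matrix.vecMul μ M = μ) (k : ℕ) :
    Matrix.vecMul μ (M ^ k) = μ := by
  induction k with
  | zero => simp
  | succ k ih => rw [pow_succ, ← Matrix.vecMul_vecMul, ih, h]

/-- A stationary distribution is close to the law of the chain at time `s * J`, for any initial
distribution. -/
lemma stationary_sum_le (hM : M ∈ Matrix.rowStochastic ℝ V) {s : ℕ} {α : ℝ} (hα1 : α ≤ 1)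
    (hα : ∀ x y, α ≤ ∑ z, min ((M ^ s) x z) ((M ^ s) y z)) {μ ν : V → ℝ}
    (hμ : μ ∈ stdSimplex ℝ V) (hst : Matrix.vecMul μ M = μ) (hν : ν ∈ stdSimplex ℝ V)
    (S : Finset V) (J : ℕ) :
    ∑ x ∈ S, μ x ≤ ∑ x ∈ S, Matrix.vecMul ν (M ^ (s * J)) x + (1 - α) ^ J := by
  set f : V → ℝ := fun x => if x ∈ S then 1 else 0 with hf
  have hosc := oscillation_pow_mulVec_le (pow_mem hM s) hα1 hα (f := f)
    (fun x y => by simp only [hf]; split_ifs <;> norm_num) J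
  have key := sum_mul_sub_le_of_oscillation hμ hν hosc
  have h : ∀ ρ : V → ℝ, ∑ x, ρ x * ((M ^ s) ^ J).mulVec f x =
      ∑ x ∈ S, Matrix.vecMul ρ (M ^ (s * J)) x := by
    intro ρ
    have := Matrix.dotProduct_mulVec ρ ((M ^ s) ^ J) f
    rw [← pow_mul] at this ⊢
    simp only [dotProduct] at this
    rw [this]
    simp [hf]
  rw [h, h, vecMul_pow_of_stationary hst] at key
  linarith

/-- When both laws are stationary, the comparison at time `s * J` on singletons does not depend on
`J` apart from an error that vanishes as `J → ∞`. -/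
lemma stationary_unique (hM : M ∈ Matrix.rowStochastic ℝ V) {s : ℕ} {α : ℝ} (hα0 : 0 < α)
    (hα1 : α ≤ 1) (hα : ∀ x y, α ≤ ∑ z, min ((M ^ s) x z) ((M ^ s) y z)) {μ ν : V → ℝ}
    (hμ : μ ∈ stdSimplex ℝ V) (hμst : Matrix.vecMul μ M = μ)
    (hν : ν ∈ stdSimplex ℝ V) (hνst : Matrix.vecMul ν M = ν) : μ = ν := by
  have hlim : Tendsto (fun J : ℕ => (1 - α) ^ J) atTop (𝓝 0) :=
    tendsto_pow_atTop_nhds_zero_of_lt_one (by linarith) (by linarith)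
  have key : ∀ {μ ν : V → ℝ}, μ ∈ stdSimplex ℝ V → Matrix.vecMul μ M = μ → ν ∈ stdSimplex ℝ V →
      Matrix.vecMul ν M = ν → ∀ x, μ x ≤ ν x := by
    intro μ ν hμ hμst hν hνst x
    refine le_of_tendsto_of_tendsto' tendsto_const_nhds (by simpa using hlim.const_add (ν x))
      fun J => ?_
    have := stationary_sum_le hM hα1 hα hμ hμst hν {x} J
    simpa [vecMul_pow_of_stationary hνst] using this
  ext x
  exact le_antisymm (key hμ hμst hν hνst x) (key hν hνst hμ hμst x)

end Stochastic

/-! ### Collision probability as a first-revisit functional -/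

section Revisit

variable {V : Type*} [Fintype V] [DecidableEq V]

/-- The weight of the trajectories of `k` steps of the kernel `Q` from `x` that hit `A` or visit a
vertex twice, plus the expectation of the payoff `H` on the other trajectories; `H` receives the
set of all vertices visited before the last one, together with `A`. -/
noncomputable def revisit (Q : Matrix V V ℝ) (H : Finset V → V → ℝ) :
    ℕ → Finset V → V → ℝ
  | 0, A, x => if x ∈ A then 1 else H A x
  | k + 1, A, x => if x ∈ A then 1 else ∑ y, Q x y * revisit Q H k (insert x A) y

/-- The payoff of a first trajectory that ends at `x` after visiting `A`: the probability that a
second trajectory of `t` steps with initial law `μ` hits this first one or itself. -/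
noncomputable def meetPayoff (Q : Matrix V V ℝ) (μ : V → ℝ) (t : ℕ) (A : Finset V) (x : V) : ℝ :=
  ∑ b, μ b * revisit Q 0 t (insert x A) b

variable {Q : Matrix V V ℝ} (hQ₀ : ∀ x y, 0 ≤ Q x y) (hQ₁ : ∀ x, ∑ y, Q x y ≤ 1)
include hQ₀ hQ₁

lemma pow_mulVec_mem_Icc {g : V → ℝ} (hg₀ : ∀ x, 0 ≤ g x) (hg₁ : ∀ x, g x ≤ 1) (k : ℕ) (x : V) :
    0 ≤ (Q ^ k).mulVec g x ∧ (Q ^ k).mulVec g x ≤ 1 := by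
  induction k generalizing x with
  | zero => simp [hg₀, hg₁]
  | succ k ih =>
    rw [pow_succ', ← Matrix.mulVec_mulVec]
    refine ⟨Finset.sum_nonneg fun y _ => mul_nonneg (hQ₀ x y) (ih y).1, le_trans ?_ (hQ₁ x)⟩
    exact Finset.sum_le_sum fun y _ => mul_le_of_le_one_right (hQ₀ x y) (ih y).2

/-- Stopping at a revisit with value `1` can only increase the expectation of a payoff bounded by
`1`. The set `A₀` allows the payoff to be compared only off vertices already visited: with `A₀ =
{x}`, the zero payoff dominates the indicator of `x`. -/
lemma pow_mulVec_le_revisit {H : Finset V → V → ℝ} {g : V → ℝ} (hg₀ : ∀ x, 0 ≤ g x)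
    (hg₁ : ∀ x, g x ≤ 1) (A₀ : Finset V) (hgH : ∀ A x, A₀ ⊆ A → x ∉ A → g x ≤ H A x)
    (k : ℕ) (A : Finset V) (hA : A₀ ⊆ A) (x : V) : (Q ^ k).mulVec g x ≤ revisit Q H k A x := by
  induction k generalizing x A with
  | zero =>
    rw [revisit]
    split_ifs with h
    · simpa using hg₁ x
    · simpa using hgH A x hA h
  | succ k ih =>
    rw [revisit]
    split_ifs with h
    · exact (pow_mulVec_mem_Icc hQ₀ hQ₁ hg₀ hg₁ _ _).2
    · rw [pow_succ', ← Matrix.mulVec_mulVec]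
      exact Finset.sum_le_sum fun y _ => mul_le_mul_of_nonneg_left
        (ih _ (hA.trans (Finset.subset_insert _ _)) y) (hQ₀ x y)

lemma sum_sq_vecMul_pow_le {μ : V → ℝ} (hμ : μ ∈ stdSimplex ℝ V) (t : ℕ) :
    ∑ z, Matrix.vecMul μ (Q ^ t) z ^ 2 ≤
      ∑ x, μ x * revisit Q (meetPayoff Q μ t) t ∅ x := by
  have hentry : ∀ z b, 0 ≤ (Q ^ t) b z ∧ (Q ^ t) b z ≤ 1 := by
    intro z b
    have := pow_mulVec_mem_Icc hQ₀ hQ₁ (g := Pi.single z 1)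
      (fun x => by by_cases h : x = z <;> simp [h])
      (fun x => by by_cases h : x = z <;> simp [h]) t b
    simpa using this
  have hmeet : ∀ A x, x ∉ A → Matrix.vecMul μ (Q ^ t) x ≤ meetPayoff Q μ t A x := by
    intro A x _
    refine Finset.sum_le_sum fun b _ => mul_le_mul_of_nonneg_left ?_ (hμ.1 b)
    have := pow_mulVec_le_revisit hQ₀ hQ₁ (H := 0) (g := Pi.single x 1)
      (fun y => by by_cases h : y = x <;> simp [h])
      (fun y => by by_cases h : y = x <;> simp [h]) {x}
      (fun B y hB hy => by
        have : y ≠ x := fun h => hy (h ▸ hB (Finset.mem_singleton_self x))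
        simp [this]) t (insert x A) (by simp) b
    simpa using this
  -- The first walk is run for `t` steps with payoff `λ_t(endpoint)`, the chance that the second
  -- walk ends at the same vertex; `hmeet` bounds this chance by that of meeting the first
  -- trajectory or itself.
  have h : ∑ z, Matrix.vecMul μ (Q ^ t) z ^ 2 =
      ∑ x, μ x * (Q ^ t).mulVec (Matrix.vecMul μ (Q ^ t)) x := by
    have := Matrix.dotProduct_mulVec μ (Q ^ t) (Matrix.vecMul μ (Q ^ t))
    simp only [dotProduct] at this
    rw [this]
    exact Finset.sum_congr rfl fun z _ => sq _
  rw [h]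
  refine Finset.sum_le_sum fun x _ => mul_le_mul_of_nonneg_left ?_ (hμ.1 x)
  refine pow_mulVec_le_revisit hQ₀ hQ₁ (fun z => ?_) (fun z => ?_) ∅
    (fun A x _ hx => hmeet A x hx) t ∅ subset_rfl x
  · exact Finset.sum_nonneg fun b _ => mul_nonneg (hμ.1 b) (hentry z b).1
  · rw [← hμ.2]
    exact Finset.sum_le_sum fun b _ => mul_le_of_le_one_right (hμ.1 b) (hentry z b).2

end Revisit

/-! ### Averaging over the environment -/

section ExpectedRevisit

variable {V : Type*} [Fintype V] [DecidableEq V]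
  {Q : (V × V → Bool) → Matrix V V ℝ}

lemma dependsOn_sum {κ : Type*} {ι : Type*} {s : Finset κ} {S : Set ι} {f : κ → (ι → Bool) → ℝ}
    (h : ∀ k ∈ s, DependsOn (f k) S) : DependsOn (fun ω => ∑ k ∈ s, f k ω) S :=
  fun _ _ hω => Finset.sum_congr rfl fun k hk => h k hk hω

lemma dependsOn_mul {ι : Type*} {S : Set ι} {f g : (ι → Bool) → ℝ}
    (hf : DependsOn f S) (hg : DependsOn g S) : DependsOn (fun ω => f ω * g ω) S :=
  fun _ _ hω => congrArg₂ _ (hf hω) (hg hω)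

variable (hQdep : ∀ x y, DependsOn (fun ω => Q ω x y) {e : V × V | e.1 = x})
include hQdep

/-- The recursion stops with value `1` on reaching `A`, so no row of a vertex of `A` is ever read.
This keeps unvisited rows fresh for the averaging. -/
lemma dependsOn_revisit {H : (V × V → Bool) → Finset V → V → ℝ}
    (hH : ∀ A x, DependsOn (fun ω => H ω A x) {e : V × V | e.1 ∉ A}) (k : ℕ) (A : Finset V) (x : V) :
    DependsOn (fun ω => revisit (Q ω) (H ω) k A x) {e : V × V | e.1 ∉ A} := by
  induction k generalizing A x with
  | zero =>
    by_cases hx : x ∈ A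
    · simp only [revisit, hx, if_true]
      exact (dependsOn_const _).mono (Set.empty_subset _)
    · simpa only [revisit, hx, if_false] using hH A x
  | succ k ih =>
    by_cases hx : x ∈ A
    · simp only [revisit, hx, if_true]
      exact (dependsOn_const _).mono (Set.empty_subset _)
    · simp only [revisit, hx, if_false]
      refine dependsOn_sum fun y _ => dependsOn_mul ((hQdep x y).mono ?_) ((ih _ y).mono ?_)
      · rintro e rfl; exact hx
      · intro e he h; exact he (Finset.mem_insert_of_mem h)

lemma dependsOn_meetPayoff (μ : V → ℝ) (t : ℕ) (A : Finset V) (x : V) :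
    DependsOn (fun ω => meetPayoff (Q ω) μ t A x) {e : V × V | e.1 ∉ A} := by
  refine dependsOn_sum fun b _ => dependsOn_mul
    ((dependsOn_const _).mono (Set.empty_subset _)) ?_
  refine (dependsOn_revisit hQdep (H := fun _ => 0)
    (fun A x => (dependsOn_const _).mono (Set.empty_subset _)) t (insert x A) b).mono ?_
  intro e he h; exact he (Finset.mem_insert_of_mem h)

variable (p : V × V → unitInterval) (hQ₀ : ∀ ω x y, 0 ≤ Q ω x y) (hQ₁ : ∀ ω x, ∑ y, Q ω x y ≤ 1)
  {v : V → ℝ} (hv : ∀ x, 1 ≤ v x) {C C₂ N : ℝ} (hN : 0 < N) (hC : 0 ≤ C) (hC₂ : 0 ≤ C₂)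
  (hv2 : ∑ x, v x ^ 2 ≤ C₂ * N)
  (hq : ∀ x y, ∫ ω, Q ω x y ∂(bernoulliPi p) ≤ C * v y / N)
include hQ₀ hQ₁ hv hN hC hC₂ hv2 hq

/-- The bound is linear in the weight `W` of the visited vertices, current one included. A step from
a fresh vertex returns to this set with averaged probability at most `C W / N`, and otherwise adds a
vertex of expected weight at most `C ∑ v² / N ≤ C C₂`. Iterating raises the coefficient of `W` by
`C` and the constant by at most `(K + C (k + 1)) C C₂`. -/
lemma integral_revisit_le {H : (V × V → Bool) → Finset V → V → ℝ}
    (hH : ∀ A x, DependsOn (fun ω => H ω A x) {e : V × V | e.1 ∉ A}) {K L : ℝ} (hK : 0 ≤ K)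
    (hL : 0 ≤ L) (hHle : ∀ A x, x ∉ A → ∫ ω, H ω A x ∂(bernoulliPi p) ≤
      (K * (∑ a ∈ A, v a + v x) + L) / N) (k : ℕ) (A : Finset V) (x : V) :
    ∫ ω, revisit (Q ω) (H ω) k A x ∂(bernoulliPi p) ≤ (if x ∈ A then 1 else 0) +
      ((K + C * k) * (∑ a ∈ A, v a + v x) + (L + k * (K + C * k) * (C * C₂))) / N := by
  have hv0 : ∀ x, 0 ≤ v x := fun x => zero_le_one.trans (hv x)
  induction k generalizing A x with
  | zero =>
    have hpos : 0 ≤ (K * (∑ a ∈ A, v a + v x) + L) / N :=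
      div_nonneg (add_nonneg (mul_nonneg hK (add_nonneg (Finset.sum_nonneg fun a _ => hv0 a)
        (hv0 x))) hL) hN.le
    by_cases hx : x ∈ A
    · simp only [revisit, hx, if_true]
      simpa using hpos
    · simp only [revisit, hx, if_false]
      simpa using hHle A x hx
  | succ k ih =>
    by_cases hx : x ∈ A
    · simp only [revisit, hx, if_true]
      have : 0 ≤ ∑ a ∈ A, v a + v x := add_nonneg (Finset.sum_nonneg fun a _ => hv0 a) (hv0 x)
      have : 0 ≤ ((K + C * (k + 1 : ℕ)) * (∑ a ∈ A, v a + v x) +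
          (L + (k + 1 : ℕ) * (K + C * (k + 1 : ℕ)) * (C * C₂))) / N := by positivity
      simpa using this
    · simp only [revisit, hx, if_false]
      rw [integral_sum_config]
      set B := insert x A with hB
      set q : V → ℝ := fun y => ∫ ω, Q ω x y ∂(bernoulliPi p) with hqdef
      have hq0 : ∀ y, 0 ≤ q y := fun y => integral_nonneg fun ω => hQ₀ ω x y
      have hqsum : ∑ y, q y ≤ 1 := by
        rw [hqdef, ← integral_sum_config]
        exact (integral_mono_config p (g := fun _ => 1) fun ω => hQ₁ ω x).trans (by simp)
      set W := ∑ a ∈ A, v a + v x with hW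
      have hWB : ∑ a ∈ B, v a = W := by rw [hB, Finset.sum_insert hx, add_comm]
      have hW0 : 0 ≤ W := add_nonneg (Finset.sum_nonneg fun a _ => hv0 a) (hv0 x)
      have h1 : ∀ y, ∫ ω, Q ω x y * revisit (Q ω) (H ω) k B y ∂(bernoulliPi p) ≤
          q y * (if y ∈ B then 1 else 0) + q y * (((K + C * k) * W +
            (L + k * (K + C * k) * (C * C₂))) / N) + q y * v y * ((K + C * k) / N) := by
        intro y
        -- The factor `Q x y` reads only row `x`, and the rest of the trajectory reads only rows
        -- outside `insert x A`.
        rw [integral_mul_of_dependsOn p (Finset.univ.filter fun e : V × V => e.1 = x)]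
        · refine (mul_le_mul_of_nonneg_left (ih B y) (hq0 y)).trans (le_of_eq ?_)
          rw [hWB]
          ring
        · simpa using hQdep x y
        · refine (dependsOn_revisit hQdep hH k B y).mono ?_
          intro e he
          simp only [Finset.coe_filter, Finset.mem_univ, true_and]
          rintro rfl
          exact he (Finset.mem_insert_self _ _)
      refine (Finset.sum_le_sum fun y _ => h1 y).trans ?_
      rw [Finset.sum_add_distrib, Finset.sum_add_distrib, ← Finset.sum_mul, ← Finset.sum_mul]
      have h2 : ∑ y, q y * (if y ∈ B then (1 : ℝ) else 0) ≤ C * W / N := by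
        simp only [mul_ite, mul_one, mul_zero]
        rw [Finset.sum_ite_mem, Finset.univ_inter, ← hWB, Finset.mul_sum, Finset.sum_div]
        exact Finset.sum_le_sum fun y _ => hq x y
      have h3 : ∑ y, q y * v y ≤ C * C₂ := by
        calc ∑ y, q y * v y ≤ ∑ y, C / N * v y ^ 2 := Finset.sum_le_sum fun y _ => by
              refine (mul_le_mul_of_nonneg_right (hq x y) (hv0 y)).trans (le_of_eq (by ring))
          _ = C / N * ∑ y, v y ^ 2 := by rw [Finset.mul_sum]
          _ ≤ C / N * (C₂ * N) := mul_le_mul_of_nonneg_left hv2 (by positivity)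
          _ = C * C₂ := by field_simp
      have h4 : (∑ y, q y) * (((K + C * k) * W + (L + k * (K + C * k) * (C * C₂))) / N) ≤
          ((K + C * k) * W + (L + k * (K + C * k) * (C * C₂))) / N :=
        mul_le_of_le_one_left (by positivity) hqsum
      have h5 : (∑ y, q y * v y) * ((K + C * k) / N) ≤ C * C₂ * ((K + C * k) / N) :=
        mul_le_mul_of_nonneg_right h3 (by positivity)
      refine (add_le_add (add_le_add h2 h4) h5).trans ?_
      rw [zero_add, mul_div_assoc', ← add_div, ← add_div]
      refine div_le_div_of_nonneg_right ?_ hN.le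
      push_cast
      have : 0 ≤ (k + 1 : ℝ) * C * (C * C₂) := by positivity
      nlinarith

/-- The expected collision probability of two independent walks in the same environment. -/
lemma integral_sum_sq_vecMul_pow_le {μ : V → ℝ} (hμ : μ ∈ stdSimplex ℝ V)
    (hμN : ∀ x, μ x ≤ 1 / N) {t : ℕ} (ht : 1 ≤ t) :
    ∫ ω, ∑ z, Matrix.vecMul μ (Q ω ^ t) z ^ 2 ∂(bernoulliPi p) ≤
      C₂ * (1 + 4 * C + 3 * C ^ 2) * t ^ 2 / N := by
  have hv0 : ∀ x, 0 ≤ v x := fun x => zero_le_one.trans (hv x)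
  have ht' : (1 : ℝ) ≤ t := by exact_mod_cast ht
  have hμv : ∑ x, μ x * v x ≤ C₂ := by
    calc ∑ x, μ x * v x ≤ ∑ x, 1 / N * v x ^ 2 := Finset.sum_le_sum fun x _ => by
          refine mul_le_mul (hμN x) ?_ (hv0 x) (by positivity)
          nlinarith [hv x]
      _ = 1 / N * ∑ x, v x ^ 2 := by rw [Finset.mul_sum]
      _ ≤ 1 / N * (C₂ * N) := mul_le_mul_of_nonneg_left hv2 (by positivity)
      _ = C₂ := by field_simp
  -- The second walk, with zero payoff. Its start already lies on the first trajectory with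
  -- probability at most `W / N`, since `μ ≤ 1 / N` and `v ≥ 1`; hence the `1` in `1 + C * t`.
  have hmeet : ∀ A x, x ∉ A → ∫ ω, meetPayoff (Q ω) μ t A x ∂(bernoulliPi p) ≤
      ((1 + C * t) * (∑ a ∈ A, v a + v x) + (C * t * C₂ + t * (C * t) * (C * C₂))) / N := by
    intro A x hx
    unfold meetPayoff
    rw [integral_sum_config]
    simp_rw [integral_const_mul]
    have h0 := fun b => integral_revisit_le hQdep p hQ₀ hQ₁ hv hN hC hC₂ hv2 hq
      (H := fun _ => 0) (fun A x => (dependsOn_const _).mono (Set.empty_subset _)) le_rfl le_rfl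
      (fun A x _ => by simp) t (insert x A) b
    have hWB : ∑ a ∈ insert x A, v a = ∑ a ∈ A, v a + v x := by
      rw [Finset.sum_insert hx, add_comm]
    set W := ∑ a ∈ A, v a + v x with hW
    rw [hWB] at h0
    refine (Finset.sum_le_sum fun b _ => mul_le_mul_of_nonneg_left (h0 b) (hμ.1 b)).trans ?_
    have h1 : ∀ b, μ b * ((if b ∈ insert x A then 1 else 0) +
        ((0 + C * t) * (W + v b) + (0 + t * (0 + C * t) * (C * C₂))) / N) =
        μ b * (if b ∈ insert x A then 1 else 0) +
        μ b * ((C * t * W + t * (C * t) * (C * C₂)) / N) + μ b * v b * (C * t / N) := by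
      intro b; ring
    simp_rw [h1]
    rw [Finset.sum_add_distrib, Finset.sum_add_distrib, ← Finset.sum_mul, ← Finset.sum_mul, hμ.2]
    have h2 : ∑ b, μ b * (if b ∈ insert x A then (1 : ℝ) else 0) ≤ W / N := by
      simp only [mul_ite, mul_one, mul_zero]
      rw [Finset.sum_ite_mem, Finset.univ_inter, ← hWB, Finset.sum_div]
      refine Finset.sum_le_sum fun y _ => (hμN y).trans ?_
      exact div_le_div_of_nonneg_right (hv y) hN.le
    have h3 := mul_le_mul_of_nonneg_right hμv (show 0 ≤ C * t / N by positivity)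
    refine (add_le_add (add_le_add_left h2 _) h3).trans (le_of_eq ?_)
    ring
  have hK : 0 ≤ 1 + C * (t : ℝ) := by positivity
  have hL : 0 ≤ C * t * C₂ + t * (C * t) * (C * C₂) := by positivity
  -- The first walk, whose payoff is the averaged meeting bound just obtained.
  have h1 := fun x => integral_revisit_le hQdep p hQ₀ hQ₁ hv hN hC hC₂ hv2 hq
    (H := fun ω => meetPayoff (Q ω) μ t) (dependsOn_meetPayoff hQdep μ t) hK hL hmeet t ∅ x
  refine (integral_mono_config p fun ω => sum_sq_vecMul_pow_le (hQ₀ ω) (hQ₁ ω) hμ t).trans ?_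
  rw [integral_sum_config]
  simp_rw [integral_const_mul]
  refine (Finset.sum_le_sum fun x _ => mul_le_mul_of_nonneg_left (h1 x) (hμ.1 x)).trans ?_
  set L := C * t * C₂ + t * (C * t) * (C * C₂) + t * (1 + C * t + C * t) * (C * C₂) with hLdef
  have h2 : ∀ x, μ x * ((if x ∈ (∅ : Finset V) then 1 else 0) +
      ((1 + C * t + C * t) * (∑ a ∈ (∅ : Finset V), v a + v x) + L) / N) =
      μ x * v x * ((1 + C * t + C * t) / N) + μ x * (L / N) := by
    intro x; simp; ring
  simp_rw [h2]
  rw [Finset.sum_add_distrib, ← Finset.sum_mul, ← Finset.sum_mul, hμ.2, one_mul]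
  refine (add_le_add_left (mul_le_mul_of_nonneg_right hμv (by positivity)) _).trans ?_
  rw [mul_div_assoc', ← add_div]
  refine div_le_div_of_nonneg_right ?_ hN.le
  have ht2 : (t : ℝ) ≤ t ^ 2 := by nlinarith
  have ht3 : (1 : ℝ) ≤ t ^ 2 := by nlinarith
  have e1 : C₂ * 1 ≤ C₂ * t ^ 2 := mul_le_mul_of_nonneg_left ht3 hC₂
  have e2 : C₂ * C * t ≤ C₂ * C * t ^ 2 := mul_le_mul_of_nonneg_left ht2 (by positivity)
  rw [hLdef]
  nlinarith

end ExpectedRevisit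

/-! ### Growth of generations and overlap of transition rows -/

section Growth

variable {n : ℕ} (ω : Fin n × Fin n → Bool)

/-- The set of out-neighbours of the vertices of `A`. -/
def outNbhd (A : Finset (Fin n)) : Finset (Fin n) :=
  Finset.univ.filter fun y => ∃ x ∈ A, ω (x, y) = true

lemma mem_outNbhd {A : Finset (Fin n)} {y : Fin n} :
    y ∈ outNbhd ω A ↔ ∃ x ∈ A, ω (x, y) = true := by simp [outNbhd]

lemma outNbhd_mono {A B : Finset (Fin n)} (h : A ⊆ B) : outNbhd ω A ⊆ outNbhd ω B := by
  intro y hy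
  obtain ⟨x, hx, hxy⟩ := (mem_outNbhd ω).1 hy
  exact (mem_outNbhd ω).2 ⟨x, h hx, hxy⟩

lemma outDegree_graph (x : Fin n) : outDegree (graph ω) x = (outNbhd ω {x}).card := by
  rw [outDegree, ← Set.ncard_coe_finset]
  congr 1
  ext y
  simp [graph, outNbhd]

lemma transition_graph_apply (x y : Fin n) :
    transition (graph ω) x y =
      if ω (x, y) = true then 1 / ((outNbhd ω {x}).card : ℝ) else 0 := by
  rw [← outDegree_graph]
  simp [transition, graph]

lemma transition_graph_nonneg (x y : Fin n) : 0 ≤ transition (graph ω) x y := by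
  rw [transition_graph_apply]; split_ifs <;> positivity

lemma sum_transition_graph (x : Fin n) :
    ∑ y, transition (graph ω) x y =
      ((outNbhd ω {x}).card : ℝ) * (1 / ((outNbhd ω {x}).card : ℝ)) := by
  simp_rw [transition_graph_apply]
  rw [← Finset.sum_filter, Finset.sum_const, nsmul_eq_mul]
  simp [outNbhd]

lemma sum_transition_graph_le_one (x : Fin n) : ∑ y, transition (graph ω) x y ≤ 1 := by
  rw [sum_transition_graph, one_div]
  exact mul_inv_le_one

lemma transition_graph_mem_rowStochastic (h : ∀ x, 0 < (outNbhd ω {x}).card) :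
    transition (graph ω) ∈ Matrix.rowStochastic ℝ (Fin n) := by
  rw [Matrix.mem_rowStochastic_iff_sum]
  refine ⟨transition_graph_nonneg ω, fun x => ?_⟩
  rw [sum_transition_graph]
  have : ((outNbhd ω {x}).card : ℝ) ≠ 0 := by exact_mod_cast (h x).ne'
  field_simp

variable {ω}

/-- A single path of length `k` from `x` to `z` already has probability at least `(1 / Δ) ^ k`. -/
lemma le_transition_pow_of_mem_iterate {Δ : ℝ} (hΔ : ∀ x, ((outNbhd ω {x}).card : ℝ) ≤ Δ)
    (hpos : ∀ x, 0 < (outNbhd ω {x}).card) (k : ℕ) (x z : Fin n)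
    (hz : z ∈ (outNbhd ω)^[k] {x}) : (1 / Δ) ^ k ≤ (transition (graph ω) ^ k) x z := by
  have hM := transition_graph_mem_rowStochastic ω hpos
  induction k generalizing z with
  | zero =>
    have : z = x := by simpa using hz
    simp [this]
  | succ k ih =>
    rw [Function.iterate_succ_apply'] at hz
    obtain ⟨y, hy, hyz⟩ := (mem_outNbhd ω).1 hz
    have h1 := ih y hy
    have hy0 : (0 : ℝ) < (outNbhd ω {y}).card := by exact_mod_cast hpos y
    have h2 : 1 / Δ ≤ transition (graph ω) y z := by
      rw [transition_graph_apply, if_pos hyz]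
      exact one_div_le_one_div_of_le hy0 (hΔ y)
    have hΔ0 : 0 ≤ 1 / Δ := by
      have := hy0.trans_le (hΔ y)
      positivity
    rw [pow_succ, pow_succ, Matrix.mul_apply]
    refine (mul_le_mul h1 h2 hΔ0 ((pow_nonneg hΔ0 k).trans h1)).trans ?_
    exact Finset.single_le_sum (f := fun j => (transition (graph ω) ^ k) x j *
      transition (graph ω) j z) (fun j _ => mul_nonneg
        (Matrix.nonneg_of_mem_rowStochastic (pow_mem hM k)) (transition_graph_nonneg ω _ _))
      (Finset.mem_univ y)

variable {g m : ℝ}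

lemma min_le_card_outNbhd (hg : 1 ≤ g) (hm : 1 ≤ m)
    (hexp : ∀ A : Finset (Fin n), A.Nonempty → (A.card : ℝ) ≤ m →
      g * A.card ≤ (outNbhd ω A).card) {A : Finset (Fin n)} (hA : A.Nonempty) :
    min (g * A.card) (g * (m / 2)) ≤ (outNbhd ω A).card := by
  by_cases h : (A.card : ℝ) ≤ m
  · exact (min_le_left _ _).trans (hexp A hA h)
  · push Not at h
    have h1 : ⌊m⌋₊ ≤ A.card := by
      -- A set larger than `m` is replaced by a subset of size `⌊m⌋`, which is at least `m / 2`
      -- because `m ≥ 1`.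
      have := Nat.floor_le (zero_le_one.trans hm)
      exact_mod_cast (this.trans h.le)
    obtain ⟨B, hBA, hB⟩ := Finset.exists_subset_card_eq h1
    have hf1 : 1 ≤ ⌊m⌋₊ := Nat.le_floor (by simpa using hm)
    have hf1' : (1 : ℝ) ≤ ⌊m⌋₊ := by exact_mod_cast hf1
    have hBne : B.Nonempty := by rw [← Finset.card_pos]; omega
    have h2 := hexp B hBne (by rw [hB]; exact Nat.floor_le (zero_le_one.trans hm))
    have h3 : ((outNbhd ω B).card : ℝ) ≤ (outNbhd ω A).card := by
      exact_mod_cast Finset.card_le_card (outNbhd_mono ω hBA)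
    have h4 : m / 2 ≤ ⌊m⌋₊ := by linarith [Nat.lt_floor_add_one m]
    rw [hB] at h2
    exact (min_le_right _ _).trans ((mul_le_mul_of_nonneg_left h4 (by linarith)).trans
      (h2.trans h3))

lemma min_le_card_iterate_outNbhd (hg : 1 ≤ g) (hm : 1 ≤ m)
    (hexp : ∀ A : Finset (Fin n), A.Nonempty → (A.card : ℝ) ≤ m →
      g * A.card ≤ (outNbhd ω A).card) (x : Fin n) (k : ℕ) :
    ((outNbhd ω)^[k] {x}).Nonempty ∧
      min (g ^ k) (g * (m / 2)) ≤ ((outNbhd ω)^[k] {x}).card := by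
  induction k with
  | zero => simp
  | succ k ih =>
    obtain ⟨hne, ih⟩ := ih
    rw [Function.iterate_succ_apply']
    set A := (outNbhd ω)^[k] {x}
    have h1 := min_le_card_outNbhd hg hm hexp hne
    have hA1 : (1 : ℝ) ≤ A.card := by exact_mod_cast hne.card_pos
    refine ⟨?_, le_trans (le_min ?_ (min_le_right _ _)) h1⟩
    · rw [← Finset.card_pos]
      have : (0 : ℝ) < min (g * A.card) (g * (m / 2)) := by
        have : 0 < g := by linarith
        have : 0 < m := by linarith
        positivity
      exact_mod_cast this.trans_le h1
    · rw [pow_succ']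
      rcases min_le_iff.1 ih with h | h
      · exact (min_le_left _ _).trans (mul_le_mul_of_nonneg_left h (by linarith))
      · refine (min_le_right _ _).trans ((h.trans ?_))
        exact le_mul_of_one_le_left (by linarith) hg

/-- In an expanding digraph, any two vertices have many common descendants in the same
generation, hence the corresponding power of the transition matrix satisfies a Dobrushin
condition. -/
lemma le_sum_min_transition_pow (hg : 1 ≤ g) (hm : 1 ≤ m)
    (hexp : ∀ A : Finset (Fin n), A.Nonempty → (A.card : ℝ) ≤ m →
      g * A.card ≤ (outNbhd ω A).card)
    {Δ : ℝ} (hΔ : ∀ x, ((outNbhd ω {x}).card : ℝ) ≤ Δ)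
    (hpos : ∀ x, 0 < (outNbhd ω {x}).card)
    {F : Finset (Fin n)} {β : ℝ}
    (hbig : ∀ A B : Finset (Fin n), B ⊆ F → g * (m / 2) ≤ A.card → β ≤ B.card →
      ∃ x ∈ A, ∃ y ∈ B, ω (x, y) = true)
    {k : ℕ} (hk : g * (m / 2) ≤ g ^ k) (x y : Fin n) :
    (F.card - 2 * β) * (1 / Δ) ^ (k + 1) ≤
      ∑ z, min ((transition (graph ω) ^ (k + 1)) x z) ((transition (graph ω) ^ (k + 1)) y z) := by
  have hM := transition_graph_mem_rowStochastic ω hpos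
  -- Generation `k` is large enough for `hbig`, so one further generation misses fewer than `β`
  -- vertices of `F`. Two such generations then share more than `F.card - 2 * β` of them.
  have hmiss : ∀ x, ((F \ (outNbhd ω)^[k + 1] {x}).card : ℝ) < β := by
    intro x
    by_contra! h
    have h1 := (min_le_card_iterate_outNbhd hg hm hexp x k).2
    rw [min_eq_right hk] at h1
    obtain ⟨a, ha, b, hb, hab⟩ := hbig _ _ Finset.sdiff_subset h1 h
    rw [Function.iterate_succ_apply', Finset.mem_sdiff, mem_outNbhd] at hb
    exact hb.2 ⟨a, ha, hab⟩
  set X := (outNbhd ω)^[k + 1] {x}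
  set Y := (outNbhd ω)^[k + 1] {y}
  have hcard : (F.card : ℝ) - 2 * β ≤ (X ∩ Y).card := by
    have hsub : F ⊆ (X ∩ Y) ∪ ((F \ X) ∪ (F \ Y)) := by
      intro z hz
      by_cases h1 : z ∈ X <;> by_cases h2 : z ∈ Y <;> simp [h1, h2, hz]
    have h1 : F.card ≤ (X ∩ Y).card + ((F \ X).card + (F \ Y).card) :=
      (Finset.card_le_card hsub).trans ((Finset.card_union_le _ _).trans
        (Nat.add_le_add_left (Finset.card_union_le _ _) _))
    have h2 : (F.card : ℝ) ≤ (X ∩ Y).card + ((F \ X).card + (F \ Y).card) := by exact_mod_cast h1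
    linarith [hmiss x, hmiss y]
  have hΔ0 : 0 ≤ Δ := (Nat.cast_nonneg _).trans (hΔ x)
  refine (mul_le_mul_of_nonneg_right hcard (by positivity)).trans ?_
  rw [← nsmul_eq_mul, ← Finset.sum_const]
  refine le_trans (Finset.sum_le_sum fun z hz => ?_)
    (Finset.sum_le_sum_of_subset_of_nonneg (Finset.subset_univ (X ∩ Y)) fun z _ _ =>
      le_min (Matrix.nonneg_of_mem_rowStochastic (pow_mem hM _))
        (Matrix.nonneg_of_mem_rowStochastic (pow_mem hM _)))
  rw [Finset.mem_inter] at hz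
  exact le_min (le_transition_pow_of_mem_iterate hΔ hpos _ x z hz.1)
    (le_transition_pow_of_mem_iterate hΔ hpos _ y z hz.2)

end Growth

/-! ### Probability estimates for fixed `n` -/

section FixedSize

variable {n : ℕ} {wOut wIn : Fin n → ℝ}

lemma log_div_nonneg (n : ℕ) : 0 ≤ Real.log n / n :=
  div_nonneg (Real.log_natCast_nonneg n) (Nat.cast_nonneg n)

lemma law_eq_bernoulliPi (wOut wIn : Fin n → ℝ) :
    law wOut wIn = bernoulliPi fun e => edgeProb wOut wIn e.1 e.2 := rfl

instance (wOut wIn : Fin n → ℝ) : IsProbabilityMeasure (law wOut wIn) := by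
  rw [law_eq_bernoulliPi]; infer_instance

lemma edgeProb_le {M₁ : ℝ} (hM₁ : ∀ x, wOut x ≤ M₁) (hpos : ∀ x, 0 < wOut x)
    (hIn : ∀ x, 0 < wIn x) (x y : Fin n) :
    (edgeProb wOut wIn x y : ℝ) ≤ M₁ * wIn y * (Real.log n / n) := by
  have hr := log_div_nonneg n
  have h1 : wOut x * wIn y * (Real.log n / n) ≤ M₁ * wIn y * (Real.log n / n) :=
    mul_le_mul_of_nonneg_right (mul_le_mul_of_nonneg_right (hM₁ x) (hIn y).le) hr
  have h0 : 0 ≤ wOut x * wIn y * (Real.log n / n) :=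
    mul_nonneg (mul_nonneg (hpos x).le (hIn y).le) hr
  unfold edgeProb
  split_ifs
  · simpa using h0.trans h1
  · rw [Set.coe_projIcc]
    exact max_le (h0.trans h1) ((min_le_right _ _).trans h1)

lemma le_edgeProb (hOut : ∀ x, 1 ≤ wOut x) (hIn : ∀ x, 0 < wIn x) {x y : Fin n} (hxy : x ≠ y)
    {b : ℝ} (hb : b ≤ wIn y) (hb1 : b * (Real.log n / n) ≤ 1) :
    b * (Real.log n / n) ≤ edgeProb wOut wIn x y := by
  unfold edgeProb
  rw [if_neg hxy, Set.coe_projIcc]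
  refine le_max_of_le_right (le_min hb1 (mul_le_mul_of_nonneg_right (hb.trans ?_)
    (log_div_nonneg n)))
  exact le_mul_of_one_le_left (hIn y).le (hOut x)

-- Chernoff's lower-tail bound at `θ = exp (-lam)`, with the disjoint blocks `A ×ˢ {y}`. Only `y ∉
-- A` count, to avoid loops, and only those of in-weight at most `B`, so that edge probabilities are
-- not truncated and no block is saturated.
open Classical in
lemma measureReal_card_outNbhd_lt_le (hOut : ∀ x, 1 ≤ wOut x) (hIn : ∀ x, 0 < wIn x)
    (A : Finset (Fin n)) {B κ M' lam c : ℝ} (hB : 0 < B) (hBr : B * (Real.log n / n) ≤ 1)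
    (hκ : A.card * (Real.log n / n) ≤ κ) (hn : 0 < n) (hlam : 0 < lam)
    (hT : M' * n ≤ ∑ y ∈ Finset.univ.filter (fun y => y ∉ A ∧ wIn y ≤ B), wIn y) :
    (law wOut wIn).real {ω | ((outNbhd ω A).card : ℝ) < c * Real.log n * A.card} ≤
      Real.exp (-((1 - Real.exp (-lam)) * M' / (1 + κ * B) - lam * c) *
        (Real.log n * A.card)) := by
  set r := Real.log n / n with hr
  have hr0 : 0 ≤ r := log_div_nonneg n
  have hn' : (0 : ℝ) < n := by exact_mod_cast hn
  have hrn : r * n = Real.log n := by rw [hr]; field_simp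
  set T := Finset.univ.filter (fun y => y ∉ A ∧ wIn y ≤ B) with hTdef
  set a : ℝ := (A.card : ℝ) with ha
  have ha0 : 0 ≤ a := Nat.cast_nonneg _
  have hκ0 : 0 ≤ κ := (mul_nonneg ha0 hr0).trans hκ
  set E : Fin n → Finset (Fin n × Fin n) := fun y => A ×ˢ {y} with hE
  set p : Fin n × Fin n → unitInterval := fun e => edgeProb wOut wIn e.1 e.2 with hp
  have hdisj : ∀ y z, y ≠ z → Disjoint (E y) (E z) := fun y z hyz =>
    Finset.disjoint_product.2 (Or.inr (by simpa using hyz))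
  have hθ1 : Real.exp (-lam) ≤ 1 := Real.exp_le_one_iff.2 (by linarith)
  have hlap := integral_pow_card_hit_le p T E hdisj (Real.exp_pos (-lam)).le hθ1
  have hsum : ∀ y ∈ T, a * wIn y * r ≤ ∑ e ∈ E y, (p e : ℝ) := by
    intro y hy
    rw [hTdef, Finset.mem_filter] at hy
    rw [hE, Finset.sum_product]
    simp only [Finset.sum_singleton]
    rw [mul_assoc, ha, ← nsmul_eq_mul]
    refine Finset.card_nsmul_le_sum _ _ _ fun x hx => ?_
    exact le_edgeProb hOut hIn (ne_of_mem_of_not_mem hx hy.2.1) le_rfl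
      ((mul_le_mul_of_nonneg_right hy.2.2 hr0).trans hBr)
  -- With `q = |A| wIn y log n / n ≤ κ B`, the chance of hitting `y` is at least `1 - exp (-q) ≥ q /
  -- (1 + q) ≥ q / (1 + κ B)`.
  have hterm : ∀ y ∈ T, a * r / (1 + κ * B) * wIn y ≤ 1 - Real.exp (-∑ e ∈ E y, (p e : ℝ)) := by
    intro y hy
    have h1 := hsum y hy
    set q := a * wIn y * r with hq
    have hq0 : 0 ≤ q := mul_nonneg (mul_nonneg ha0 (hIn y).le) hr0
    have hqB : q ≤ κ * B := by
      have : q = a * r * wIn y := by rw [hq]; ring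
      rw [this]
      exact mul_le_mul hκ (Finset.mem_filter.1 hy).2.2 (hIn y).le hκ0
    have h2 : Real.exp (-∑ e ∈ E y, (p e : ℝ)) ≤ 1 / (1 + q) := by
      refine (Real.exp_le_exp.2 (neg_le_neg h1)).trans ?_
      rw [Real.exp_neg, ← one_div]
      exact one_div_le_one_div_of_le (by linarith) (by linarith [Real.add_one_le_exp q])
    have h3 : a * r / (1 + κ * B) * wIn y = q / (1 + κ * B) := by rw [hq]; ring
    have h4 : q / (1 + κ * B) ≤ q / (1 + q) :=
      div_le_div_of_nonneg_left hq0 (by linarith) (by linarith)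
    have h5 : q / (1 + q) = 1 - 1 / (1 + q) := by
      field_simp; ring
    rw [h3]
    linarith
  have htot : M' / (1 + κ * B) * (Real.log n * a) ≤
      ∑ y ∈ T, (1 - Real.exp (-∑ e ∈ E y, (p e : ℝ))) := by
    refine le_trans ?_ (Finset.sum_le_sum hterm)
    rw [← Finset.mul_sum]
    refine le_trans (le_of_eq ?_) (mul_le_mul_of_nonneg_left hT (by positivity))
    rw [← hrn]; ring
  have hsub : {ω | ((outNbhd ω A).card : ℝ) < c * Real.log n * a} ⊆
      {ω | Real.exp (-lam * (c * Real.log n * a)) ≤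
        Real.exp (-lam) ^ (T.filter fun y => ∃ i ∈ E y, ω i = true).card} := by
    intro ω hω
    rw [Set.mem_ofPred_eq] at hω ⊢
    rw [← Real.exp_nat_mul]
    refine Real.exp_le_exp.2 ?_
    have h1 : (T.filter fun y => ∃ i ∈ E y, ω i = true).card ≤ (outNbhd ω A).card := by
      refine Finset.card_le_card fun y hy => ?_
      obtain ⟨i, hi, h⟩ := (Finset.mem_filter.1 hy).2
      rw [hE, Finset.mem_product, Finset.mem_singleton] at hi
      refine (mem_outNbhd ω).2 ⟨i.1, hi.1, ?_⟩
      rw [← hi.2]; exact h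
    have h2 : ((T.filter fun y => ∃ i ∈ E y, ω i = true).card : ℝ) ≤ (outNbhd ω A).card := by
      exact_mod_cast h1
    nlinarith
  refine (measureReal_mono hsub (measure_ne_top _ _)).trans ?_
  rw [law_eq_bernoulliPi]
  refine (measureReal_le_integral_div _ (fun ω => by positivity) (Real.exp_pos _)).trans ?_
  rw [div_le_iff₀ (Real.exp_pos _), ← Real.exp_add]
  refine hlap.trans (Real.exp_le_exp.2 ?_)
  have := mul_le_mul_of_nonneg_left htot (sub_nonneg.2 hθ1)
  have e : (1 - Real.exp (-lam)) * (M' / (1 + κ * B) * (Real.log n * a)) =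
    (1 - Real.exp (-lam)) * M' / (1 + κ * B) * (Real.log n * a) := by ring
  rw [e] at this
  linarith

/-- Each set costs `ρ ^ |A|` with `ρ = n ^ (-(1 + i))`, and summing over nonempty sets gives `(1 +
ρ) ^ n - 1`. An exponent above `1` is what makes this vanish. -/
lemma measureReal_exists_finset_le (P : Finset (Fin n) → Set (Fin n × Fin n → Bool))
    {i : ℝ} (hn : 0 < n)
    (h : ∀ A : Finset (Fin n), A.Nonempty →
      (law wOut wIn).real (P A) ≤ Real.exp (-(1 + i) * (Real.log n * A.card))) :
    (law wOut wIn).real {ω | ∃ A : Finset (Fin n), A.Nonempty ∧ ω ∈ P A} ≤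
      Real.exp ((n : ℝ) ^ (-i)) - 1 := by
  classical
  have hn' : (0 : ℝ) < n := by exact_mod_cast hn
  set ρ : ℝ := (n : ℝ) ^ (-(1 + i)) with hρ
  have hρ0 : 0 ≤ ρ := by positivity
  have hsub : {ω | ∃ A : Finset (Fin n), A.Nonempty ∧ ω ∈ P A} ⊆
      ⋃ A ∈ (Finset.univ : Finset (Finset (Fin n))).erase ∅, P A := by
    rintro ω ⟨A, hA, hω⟩
    simp only [Set.mem_iUnion]
    exact ⟨A, by simpa using hA.ne_empty, hω⟩
  refine (measureReal_mono hsub (measure_ne_top _ _)).trans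
    ((measureReal_biUnion_finset_le _ _).trans ?_)
  have h1 : ∀ A ∈ (Finset.univ : Finset (Finset (Fin n))).erase ∅,
      (law wOut wIn).real (P A) ≤ ρ ^ A.card := by
    intro A hA
    refine (h A (Finset.nonempty_iff_ne_empty.2 (Finset.ne_of_mem_erase hA))).trans (le_of_eq ?_)
    rw [hρ, Real.rpow_def_of_pos hn', ← Real.exp_nat_mul]
    congr 1; ring
  refine (Finset.sum_le_sum h1).trans ?_
  have h2 : ∑ A : Finset (Fin n), ρ ^ A.card = (1 + ρ) ^ n := by
    have := Finset.sum_pow_mul_eq_add_pow ρ 1 (Finset.univ : Finset (Fin n))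
    simp only [one_pow, mul_one, Finset.card_univ, Fintype.card_fin, Finset.powerset_univ] at this
    rw [this, add_comm]
  have h3 := Finset.sum_erase_add Finset.univ (fun A : Finset (Fin n) => ρ ^ A.card)
    (Finset.mem_univ ∅)
  rw [h2] at h3
  simp only [Finset.card_empty, pow_zero] at h3
  have h4 : (1 + ρ) ^ n ≤ Real.exp ((n : ℝ) ^ (-i)) := by
    have h5 : 1 + ρ ≤ Real.exp ρ := by linarith [Real.add_one_le_exp ρ]
    refine (pow_le_pow_left₀ (by linarith) h5 n).trans (le_of_eq ?_)
    rw [← Real.exp_nat_mul, hρ]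
    congr 1
    rw [show -i = 1 + -(1 + i) by ring, Real.rpow_add hn', Real.rpow_one]
  linarith

lemma measureReal_no_edge_between_le (hOut : ∀ x, 1 ≤ wOut x) (hIn : ∀ x, 0 < wIn x)
    {F : Finset (Fin n)} {b K β : ℝ} (hF : ∀ y ∈ F, b ≤ wIn y) (hb : 0 ≤ b)
    (hbr : b * (Real.log n / n) ≤ 1) (hβ : 1 ≤ β) :
    (law wOut wIn).real {ω : Fin n × Fin n → Bool | ∃ A B : Finset (Fin n), B ⊆ F ∧ K ≤ A.card ∧ β ≤ B.card ∧
      ∀ x ∈ A, ∀ y ∈ B, ω (x, y) = false} ≤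
      4 ^ n * Real.exp (-(K * (β - 1) * (b * (Real.log n / n)))) := by
  classical
  set r := Real.log n / n
  have hr0 : 0 ≤ r := log_div_nonneg n
  set S := (Finset.univ : Finset (Finset (Fin n) × Finset (Fin n))).filter fun AB =>
    AB.2 ⊆ F ∧ K ≤ AB.1.card ∧ β ≤ AB.2.card with hS
  have hsub : {ω : Fin n × Fin n → Bool | ∃ A B : Finset (Fin n), B ⊆ F ∧ K ≤ A.card ∧ β ≤ B.card ∧
      ∀ x ∈ A, ∀ y ∈ B, ω (x, y) = false} ⊆
      ⋃ AB ∈ S, {ω : Fin n × Fin n → Bool | ∀ e ∈ (AB.1 ×ˢ AB.2).filter (fun e => e.1 ≠ e.2), ω e = false} := by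
    rintro ω ⟨A, B, h1, h2, h3, h4⟩
    simp only [Set.mem_iUnion]
    refine ⟨(A, B), by simp [hS, h1, h2, h3], ?_⟩
    intro e he
    have := (Finset.mem_filter.1 he).1
    rw [Finset.mem_product] at this
    exact h4 _ this.1 _ this.2
  refine (measureReal_mono hsub (measure_ne_top _ _)).trans
    ((measureReal_biUnion_finset_le _ _).trans ?_)
  have h1 : ∀ AB ∈ S, (law wOut wIn).real
      {ω : Fin n × Fin n → Bool | ∀ e ∈ (AB.1 ×ˢ AB.2).filter (fun e => e.1 ≠ e.2), ω e = false} ≤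
      Real.exp (-(K * (β - 1) * (b * r))) := by
    rintro ⟨A, B⟩ hAB
    obtain ⟨hBF, hKA, hβB⟩ := (Finset.mem_filter.1 hAB).2
    simp only at hBF hKA hβB ⊢
    rw [law_eq_bernoulliPi]
    refine (measureReal_absent_le _ _).trans (Real.exp_le_exp.2 (neg_le_neg ?_))
    -- One vertex of `B` is lost for each `x ∈ A`, as loops are absent.
    have hcard : K * (β - 1) ≤ ((A ×ˢ B).filter (fun e => e.1 ≠ e.2)).card := by
      have h2 : A.card * (B.card - 1) ≤ ((A ×ˢ B).filter (fun e => e.1 ≠ e.2)).card := by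
        have h3 : (A ×ˢ B).filter (fun e => e.1 ≠ e.2) = (A.sigma (fun x => B.erase x)).map
            (Equiv.sigmaEquivProd _ _).toEmbedding := by
          ext ⟨x, y⟩
          simp [Finset.mem_map_equiv]
          tauto
        rw [h3, Finset.card_map, Finset.card_sigma, ← smul_eq_mul]
        exact Finset.card_nsmul_le_sum _ _ _ fun x _ => Finset.pred_card_le_card_erase
      have hB1 : 1 ≤ B.card := by
        have := hβ.trans hβB
        exact_mod_cast this
      have h4 : (A.card : ℝ) * (B.card - 1) ≤ ((A ×ˢ B).filter (fun e => e.1 ≠ e.2)).card := by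
        have : ((A.card * (B.card - 1) : ℕ) : ℝ) ≤
          ((A ×ˢ B).filter (fun e => e.1 ≠ e.2)).card := by exact_mod_cast h2
        push_cast [hB1] at this
        exact this
      exact (mul_le_mul hKA (by linarith) (by linarith) (by linarith)).trans h4
    refine (mul_le_mul_of_nonneg_right hcard (mul_nonneg hb hr0)).trans ?_
    rw [← nsmul_eq_mul]
    refine Finset.card_nsmul_le_sum _ _ _ fun e he => ?_
    rw [Finset.mem_filter, Finset.mem_product] at he
    exact le_edgeProb hOut hIn he.2 (hF _ (hBF he.1.2)) hbr
  refine (Finset.sum_le_card_nsmul _ _ _ h1).trans ?_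
  rw [nsmul_eq_mul]
  refine mul_le_mul_of_nonneg_right ?_ (Real.exp_pos _).le
  have : S.card ≤ 4 ^ n := by
    refine (Finset.card_le_univ _).trans (le_of_eq ?_)
    simp only [Fintype.card_prod, Fintype.card_finset, Fintype.card_fin]
    rw [← mul_pow]; norm_num
  exact_mod_cast this

lemma measureReal_lt_card_outNbhd_le {M₁ : ℝ} (hM₁ : ∀ x, wOut x ≤ M₁) (hpos : ∀ x, 0 < wOut x)
    (hIn : ∀ x, 0 < wIn x) (hsum : ∑ x, wOut x = ∑ x, wIn x) (hn : 0 < n) (Δ : ℝ) :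
    (law wOut wIn).real {ω | ∃ x, Δ < ((outNbhd ω {x}).card : ℝ)} ≤
      n * Real.exp (2 * M₁ ^ 2 * Real.log n - Δ) := by
  classical
  have hn' : (0 : ℝ) < n := by exact_mod_cast hn
  have hM0 : 0 ≤ M₁ := (hpos ⟨0, hn⟩).le.trans (hM₁ _)
  set p : Fin n × Fin n → unitInterval := fun e => edgeProb wOut wIn e.1 e.2 with hp
  have hsub : {ω | ∃ x, Δ < ((outNbhd ω {x}).card : ℝ)} ⊆
      ⋃ x ∈ (Finset.univ : Finset (Fin n)),
        {ω | Real.exp Δ ≤ Real.exp ((outNbhd ω {x}).card : ℝ)} := by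
    rintro ω ⟨x, hx⟩
    simp only [Set.mem_iUnion]
    exact ⟨x, Finset.mem_univ _, Real.exp_le_exp.2 hx.le⟩
  refine (measureReal_mono hsub (measure_ne_top _ _)).trans
    ((measureReal_biUnion_finset_le _ _).trans ?_)
  have h1 : ∀ x ∈ (Finset.univ : Finset (Fin n)), (law wOut wIn).real
      {ω | Real.exp Δ ≤ Real.exp ((outNbhd ω {x}).card : ℝ)} ≤
      Real.exp (2 * M₁ ^ 2 * Real.log n - Δ) := by
    intro x _
    rw [law_eq_bernoulliPi]
    refine (measureReal_le_integral_div _ (fun ω => (Real.exp_pos _).le) (Real.exp_pos _)).trans ?_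
    rw [Real.exp_sub]
    refine div_le_div_of_nonneg_right ?_ (Real.exp_pos _).le
    have h2 : ∀ ω : Fin n × Fin n → Bool, Real.exp ((outNbhd ω {x}).card : ℝ) =
        ∏ e, (if e.1 = x then (if ω e = true then Real.exp 1 else 1) else 1) := by
      intro ω
      rw [Fintype.prod_prod_type, Finset.prod_eq_single x (fun z _ hz => by simp [hz]) (by simp)]
      simp only [if_true]
      rw [← Finset.prod_filter, Finset.prod_const, ← Real.exp_nat_mul, mul_one]
      simp [outNbhd]
    simp_rw [h2]
    rw [integral_bernoulliPi_prod p
      (fun e b => if e.1 = x then (if b = true then Real.exp 1 else 1) else 1)]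
    rw [Fintype.prod_prod_type, Finset.prod_eq_single x (fun z _ hz => by simp [hz]) (by simp)]
    have hW : ∑ y, M₁ * wIn y * (Real.log n / n) ≤ M₁ ^ 2 * Real.log n := by
      rw [← Finset.sum_mul, ← Finset.mul_sum, ← hsum]
      have h3 : ∑ x, wOut x ≤ n * M₁ := by
        refine (Finset.sum_le_card_nsmul _ _ _ fun x _ => hM₁ x).trans (le_of_eq (by simp))
      refine (mul_le_mul_of_nonneg_right (mul_le_mul_of_nonneg_left h3 hM0)
        (log_div_nonneg n)).trans (le_of_eq ?_)
      field_simp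
    -- This is `1 + (e - 1) p ≤ exp (2 p)`, as `e - 1 < 2`.
    have h3 : ∀ y, (p (x, y) : ℝ) * Real.exp 1 + (1 - p (x, y)) ≤
        Real.exp (2 * (M₁ * wIn y * (Real.log n / n))) := by
      intro y
      have h4 := edgeProb_le hM₁ hpos hIn x y
      have h5 := Real.exp_one_lt_d9
      have h6 := (p (x, y)).2.1
      have h7 := Real.add_one_le_exp (2 * (M₁ * wIn y * (Real.log n / n)))
      have h8 : (p (x, y) : ℝ) ≤ M₁ * wIn y * (Real.log n / n) := h4
      nlinarith
    simp only [if_true, mul_one, Bool.false_eq_true, if_false]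
    refine (Finset.prod_le_prod (fun y _ => ?_) fun y _ => h3 y).trans ?_
    · have h6 := (p (x, y)).2.1
      have h7 := (p (x, y)).2.2
      exact add_nonneg (mul_nonneg h6 (Real.exp_pos _).le) (by linarith)
    · rw [← Real.exp_sum, ← Finset.mul_sum]
      exact Real.exp_le_exp.2 (by linarith)
  refine (Finset.sum_le_card_nsmul _ _ _ h1).trans (le_of_eq ?_)
  simp

open Classical in
/-- The transition matrix without the rows of the vertices of out-degree less than `g`. -/
noncomputable def truncTransition (g : ℝ) (ω : Fin n × Fin n → Bool) :
    Matrix (Fin n) (Fin n) ℝ :=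
  Matrix.of fun x y => if g ≤ (outNbhd ω {x}).card then transition (graph ω) x y else 0

lemma truncTransition_nonneg (g : ℝ) (ω : Fin n × Fin n → Bool) (x y : Fin n) :
    0 ≤ truncTransition g ω x y := by
  simp only [truncTransition, Matrix.of_apply]
  split_ifs
  · exact transition_graph_nonneg ω x y
  · exact le_rfl

lemma sum_truncTransition_le_one (g : ℝ) (ω : Fin n × Fin n → Bool) (x : Fin n) :
    ∑ y, truncTransition g ω x y ≤ 1 := by
  refine le_trans (Finset.sum_le_sum fun y _ => ?_) (sum_transition_graph_le_one ω x)
  simp only [truncTransition, Matrix.of_apply]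
  split_ifs
  · exact le_rfl
  · exact transition_graph_nonneg ω x y

lemma truncTransition_eq {g : ℝ} {ω : Fin n × Fin n → Bool}
    (h : ∀ x, g ≤ (outNbhd ω {x}).card) : truncTransition g ω = transition (graph ω) := by
  ext x y
  simp [truncTransition, h]

lemma dependsOn_truncTransition (g : ℝ) (x y : Fin n) :
    DependsOn (fun ω => truncTransition g ω x y) {e : Fin n × Fin n | e.1 = x} := by
  intro ω ω' h
  have h1 : ∀ z, ω (x, z) = ω' (x, z) := fun z => h (x, z) rfl
  have h2 : outNbhd ω {x} = outNbhd ω' {x} := by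
    ext z; simp [mem_outNbhd, h1]
  simp only [truncTransition, Matrix.of_apply, transition_graph_apply, h1, h2]

/-- A surviving row has degree at least `g`, so its entry is at most `1 / g` times the edge
indicator. Thus the random degree in the denominator disappears before averaging. -/
lemma integral_truncTransition_le {M₁ g : ℝ} (hM₁ : ∀ x, wOut x ≤ M₁) (hpos : ∀ x, 0 < wOut x)
    (hIn : ∀ x, 0 < wIn x) (hg : 0 < g) (x y : Fin n) :
    ∫ ω, truncTransition g ω x y
        ∂(bernoulliPi fun e : Fin n × Fin n => edgeProb wOut wIn e.1 e.2) ≤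
      M₁ * wIn y * (Real.log n / n) / g := by
  classical
  have h1 : ∀ ω : Fin n × Fin n → Bool, truncTransition g ω x y ≤
      1 / g - 1 / g * (if ∀ i ∈ ({(x, y)} : Finset (Fin n × Fin n)), ω i = false then 1 else 0) := by
    intro ω
    simp only [truncTransition, Matrix.of_apply, transition_graph_apply, Finset.mem_singleton,
      forall_eq]
    cases hω : ω (x, y)
    · simp
    · simp only [Bool.true_eq_false, if_false, if_true, mul_zero, sub_zero]
      split_ifs with h
      · exact one_div_le_one_div_of_le hg h
      · positivity
  refine (integral_mono_config _ h1).trans ?_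
  have h0 : ∫ ω : Fin n × Fin n → Bool,
      (if ∀ i ∈ ({(x, y)} : Finset (Fin n × Fin n)), ω i = false then (1 : ℝ) else 0)
        ∂(bernoulliPi fun e : Fin n × Fin n => edgeProb wOut wIn e.1 e.2) =
      ∏ i ∈ {(x, y)}, (1 - (edgeProb wOut wIn i.1 i.2 : ℝ)) := by
    convert integral_indicator_absent _ _
  rw [integral_sub Integrable.of_finite Integrable.of_finite, integral_const_mul, h0]
  have := edgeProb_le hM₁ hpos hIn x y
  simp only [integral_const, probReal_univ, smul_eq_mul, one_mul, Finset.prod_singleton]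
  rw [← mul_one_sub, sub_sub_cancel, one_div_mul_eq_div]
  exact div_le_div_of_nonneg_right this hg.le

end FixedSize

/-! ### Consequences of the second moment of the in-weights -/

section Weights

variable {n : ℕ} {w : Fin n → ℝ}

lemma sum_sq_le_of_sum_rpow_le (hw : ∀ x, 0 < w x) {η M₂ : ℝ} (hη : 0 < η)
    (h : ∑ x, w x ^ (2 + η) ≤ M₂ * n) : ∑ x, w x ^ 2 ≤ (1 + M₂) * n := by
  have h1 : ∀ x, w x ^ 2 ≤ 1 + w x ^ (2 + η) := by
    intro x
    have h0 := Real.rpow_nonneg (hw x).le (2 + η)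
    rcases le_total (w x) 1 with hx | hx
    · have : w x ^ 2 ≤ 1 := pow_le_one₀ (hw x).le hx
      linarith
    · have : w x ^ (2 : ℝ) ≤ w x ^ (2 + η) := Real.rpow_le_rpow_of_exponent_le hx (by linarith)
      rw [Real.rpow_two] at this
      linarith
  refine (Finset.sum_le_sum fun x _ => h1 x).trans ?_
  rw [Finset.sum_add_distrib]
  simp only [Finset.sum_const, Finset.card_univ, Fintype.card_fin, nsmul_eq_mul, mul_one]
  linarith

-- Weights above `B` carry total mass at most `∑ w² / B`, and the remaining vertices of `A` at most
-- `B` each.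
open Classical in
lemma le_sum_filter_le (hw : ∀ x, 0 < w x) {M₀ C B : ℝ} (hB : 0 < B)
    (hsum : M₀ * n ≤ ∑ x, w x) (hsq : ∑ x, w x ^ 2 ≤ C * n) (A : Finset (Fin n)) :
    (M₀ - C / B) * n - B * A.card ≤
      ∑ y ∈ Finset.univ.filter (fun y => y ∉ A ∧ w y ≤ B), w y := by
  have h1 := Finset.sum_filter_add_sum_filter_not Finset.univ (fun y => y ∉ A ∧ w y ≤ B) w
  have h2 : ∑ y ∈ Finset.univ.filter (fun y => ¬(y ∉ A ∧ w y ≤ B)), w y ≤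
      ∑ y, (w y ^ 2 / B + if y ∈ A then B else 0) := by
    rw [Finset.sum_filter]
    refine Finset.sum_le_sum fun y _ => ?_
    have h3 : 0 ≤ w y ^ 2 / B := by positivity
    have h4 : (0 : ℝ) ≤ if y ∈ A then B else 0 := by split_ifs <;> linarith
    by_cases hy : w y ≤ B
    · by_cases hA : y ∈ A
      · simp only [hA, not_true_eq_false, false_and, not_false_eq_true, if_true]
        linarith
      · simp only [hA, hy, not_false_eq_true, and_self, not_true_eq_false, if_false]
        linarith
    · simp only [hy, and_false, not_false_eq_true, if_true]
      have h5 : w y ≤ w y ^ 2 / B := by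
        rw [le_div_iff₀ hB, sq]
        exact mul_le_mul_of_nonneg_left (not_le.1 hy).le (hw y).le
      linarith
  rw [Finset.sum_add_distrib, ← Finset.sum_div, Finset.sum_ite_mem, Finset.univ_inter,
    Finset.sum_const, nsmul_eq_mul] at h2
  have h6 : (∑ y, w y ^ 2) / B ≤ C * n / B := div_le_div_of_nonneg_right hsq hB.le
  have h7 : (M₀ - C / B) * n = M₀ * n - C * n / B := by ring
  rw [h7]
  linarith

/-- A Paley–Zygmund argument: weights below `1 / 2` carry at most half of the mass `n`, and
Cauchy–Schwarz bounds the number of vertices carrying the rest. -/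
lemma le_card_filter_half_le (hw : ∀ x, 0 < w x) {C : ℝ} (hC : 0 < C)
    (hsum : (n : ℝ) ≤ ∑ x, w x) (hsq : ∑ x, w x ^ 2 ≤ C * n) :
    n / (4 * C) ≤ ((Finset.univ.filter fun y => 1 / 2 ≤ w y).card : ℝ) := by
  classical
  rcases Nat.eq_zero_or_pos n with rfl | hn
  · simp
  have hn' : (0 : ℝ) < n := by exact_mod_cast hn
  set F := Finset.univ.filter fun y => 1 / 2 ≤ w y
  have h1 := Finset.sum_filter_add_sum_filter_not Finset.univ (fun y => 1 / 2 ≤ w y) w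
  have h2 : ∑ y ∈ Finset.univ.filter (fun y => ¬ 1 / 2 ≤ w y), w y ≤ n * (1 / 2) := by
    refine (Finset.sum_le_card_nsmul _ _ (1 / 2) fun y hy =>
      (not_le.1 (Finset.mem_filter.1 hy).2).le).trans ?_
    rw [nsmul_eq_mul]
    refine mul_le_mul_of_nonneg_right ?_ (by norm_num)
    exact_mod_cast (Finset.card_le_univ _).trans (by simp)
  have h3 : (n : ℝ) / 2 ≤ ∑ y ∈ F, w y := by linarith
  have h4 : (∑ y ∈ F, w y) ^ 2 ≤ F.card * (C * n) := by
    refine (sq_sum_le_card_mul_sum_sq).trans (mul_le_mul_of_nonneg_left (le_trans ?_ hsq)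
      (Nat.cast_nonneg _))
    exact Finset.sum_le_sum_of_subset_of_nonneg (Finset.subset_univ _) fun _ _ _ => sq_nonneg _
  have h5 : ((n : ℝ) / 2) ^ 2 ≤ F.card * (C * n) :=
    (pow_le_pow_left₀ (by positivity) h3 2).trans h4
  rw [div_le_iff₀ (by positivity)]
  have h6 : (n : ℝ) * n ≤ (F.card * (4 * C)) * n := by nlinarith
  exact le_of_mul_le_mul_right h6 hn'

end Weights

/-- The choices give `1 - exp (-lam) = (M + 1) / (2 M)` and `1 + κ B = 2 (M + 1) / (M + 3)`. The
quotient is `1 + (M - 1) / 4`, half of whose excess over `1` is spent on `lam * c`. -/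
lemma exists_expansion_constants {M B : ℝ} (hM : 1 < M) (hB : 0 < B) :
    ∃ lam κ c i : ℝ, 0 < lam ∧ 0 < κ ∧ 0 < c ∧ 0 < i ∧
      (1 - Real.exp (-lam)) * M / (1 + κ * B) - lam * c = 1 + i := by
  have hlam : 0 < Real.log (2 * M / (M - 1)) := by
    refine Real.log_pos ?_
    rw [lt_div_iff₀ (by linarith)]; linarith
  refine ⟨Real.log (2 * M / (M - 1)), (M - 1) / (M + 3) / B,
    (M - 1) / 8 / Real.log (2 * M / (M - 1)), (M - 1) / 8, hlam, ?_, ?_, by linarith, ?_⟩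
  · have : 0 < M - 1 := by linarith
    positivity
  · have : 0 < M - 1 := by linarith
    positivity
  · have h1 : 0 < M - 1 := by linarith
    have h2 : 0 < 2 * M / (M - 1) := by positivity
    rw [Real.exp_neg, Real.exp_log h2, div_mul_cancel₀ _ hB.ne', mul_div_cancel₀ _ hlam.ne']
    have h3 : 1 + (M - 1) / (M + 3) = 2 * (M + 1) / (M + 3) := by
      field_simp; ring
    rw [h3, inv_div]
    field_simp
    ring

lemma tendsto_log_natCast : Tendsto (fun n : ℕ => Real.log n) atTop atTop :=
  Real.tendsto_log_atTop.comp tendsto_natCast_atTop_atTop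

lemma tendsto_log_div_natCast : Tendsto (fun n : ℕ => Real.log n / n) atTop (𝓝 0) :=
  (Real.isLittleO_log_id_atTop.tendsto_div_nhds_zero).comp tendsto_natCast_atTop_atTop

lemma tendsto_natCast_rpow_neg {a : ℝ} (ha : 0 < a) :
    Tendsto (fun n : ℕ => (n : ℝ) ^ (-a)) atTop (𝓝 0) :=
  (tendsto_rpow_neg_atTop ha).comp tendsto_natCast_atTop_atTop

/-! ### The bad events have vanishing probability -/

section Asymptotics

variable {wOut wIn : (n : ℕ) → Fin n → ℝ} {M₀ M₁ C : ℝ}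

lemma tendsto_measureReal_not_expanding (hOut : ∀ n x, 1 ≤ wOut n x) (hIn : ∀ n x, 0 < wIn n x)
    (hM₀ : 1 < M₀) (hsum : ∀ n : ℕ, M₀ * n ≤ ∑ x, wIn n x) (hC : 0 < C)
    (hsq : ∀ n : ℕ, ∑ x, wIn n x ^ 2 ≤ C * n) :
    ∃ κ c : ℝ, 0 < κ ∧ 0 < c ∧ Tendsto (fun n : ℕ => (law (wOut n) (wIn n)).real
      {ω | ∃ A : Finset (Fin n), A.Nonempty ∧ ((A.card : ℝ) ≤ κ * n / Real.log n ∧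
        ((outNbhd ω A).card : ℝ) < c * Real.log n * A.card)}) atTop (𝓝 0) := by
  have hM : 0 < M₀ - 1 := by linarith
  -- Removing heavy weights costs `C / B = (M₀ - 1) / 4` per vertex, and removing `A` at most as
  -- much for large `n`. The mean weight left is at least `(1 + M₀) / 2 > 1`.
  set B : ℝ := 4 * C / (M₀ - 1) with hB
  have hB0 : 0 < B := by positivity
  obtain ⟨lam, κ, c, i, hlam, hκ, hc, hi, hconst⟩ :=
    exists_expansion_constants (M := (1 + M₀) / 2) (by linarith) hB0
  refine ⟨κ, c, hκ, hc, ?_⟩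
  have hlim : Tendsto (fun n : ℕ => Real.exp ((n : ℝ) ^ (-i)) - 1) atTop (𝓝 0) := by
    have := ((Real.continuous_exp.tendsto 0).comp (tendsto_natCast_rpow_neg hi)).sub_const 1
    simpa using this
  refine tendsto_of_tendsto_of_tendsto_of_le_of_le' tendsto_const_nhds hlim
    (Eventually.of_forall fun n => measureReal_nonneg) ?_
  have hBr : ∀ᶠ n : ℕ in atTop, B * (Real.log n / n) ≤ 1 := by
    have := tendsto_log_div_natCast.const_mul B
    rw [mul_zero] at this
    exact this.eventually_le_const (by norm_num)
  filter_upwards [hBr, eventually_gt_atTop 0,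
    tendsto_log_natCast.eventually_ge_atTop (4 * (B * κ) / (M₀ - 1)),
    tendsto_log_natCast.eventually_gt_atTop 0] with n hBr hn hlog hlog0
  have hn' : (0 : ℝ) < n := by exact_mod_cast hn
  refine measureReal_exists_finset_le (fun A => {ω | (A.card : ℝ) ≤ κ * n / Real.log n ∧
        ((outNbhd ω A).card : ℝ) < c * Real.log n * A.card}) hn fun A _ => ?_
  by_cases hA : (A.card : ℝ) ≤ κ * n / Real.log n
  · have hκA : A.card * (Real.log n / n) ≤ κ := by
      refine (mul_le_mul_of_nonneg_right hA (log_div_nonneg n)).trans (le_of_eq ?_)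
      field_simp
    have hT : (1 + M₀) / 2 * n ≤
        ∑ y ∈ Finset.univ.filter (fun y => y ∉ A ∧ wIn n y ≤ B), wIn n y := by
      refine le_trans ?_ (le_sum_filter_le (hIn n) hB0 (hsum n) (hsq n) A)
      have h1 : C / B = (M₀ - 1) / 4 := by rw [hB]; field_simp
      have h2 : B * A.card ≤ (M₀ - 1) / 4 * n := by
        refine (mul_le_mul_of_nonneg_left hA hB0.le).trans ?_
        rw [← mul_div_assoc, div_le_iff₀ hlog0]
        rw [div_le_iff₀ hM] at hlog
        nlinarith
      rw [h1]
      nlinarith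
    have := measureReal_card_outNbhd_lt_le (hOut n) (hIn n) A hB0 hBr hκA hn hlam (c := c) hT
    rw [hconst] at this
    exact (measureReal_mono (fun ω hω => hω.2)).trans this
  · simp only [hA, false_and, Set.ofPred_false, measureReal_empty]
    exact (Real.exp_pos _).le

lemma tendsto_measureReal_no_edge_between (hOut : ∀ n x, 1 ≤ wOut n x)
    (hIn : ∀ n x, 0 < wIn n x) {a b : ℝ} (ha : 0 < a) (hb : 0 < b) :
    Tendsto (fun n : ℕ => (law (wOut n) (wIn n)).real
      {ω | ∃ A B : Finset (Fin n), B ⊆ (Finset.univ.filter fun y => 1 / 2 ≤ wIn n y) ∧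
        a * n ≤ A.card ∧ b * n ≤ B.card ∧ ∀ x ∈ A, ∀ y ∈ B, ω (x, y) = false}) atTop (𝓝 0) := by
  have hlim : Tendsto (fun n : ℕ => Real.exp (-(n : ℝ))) atTop (𝓝 0) :=
    Real.tendsto_exp_neg_atTop_nhds_zero.comp tendsto_natCast_atTop_atTop
  refine tendsto_of_tendsto_of_tendsto_of_le_of_le' tendsto_const_nhds hlim
    (Eventually.of_forall fun n => measureReal_nonneg) ?_
  have hBr : ∀ᶠ n : ℕ in atTop, 1 / 2 * (Real.log n / n) ≤ 1 := by
    have := tendsto_log_div_natCast.const_mul (1 / 2)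
    rw [mul_zero] at this
    exact this.eventually_le_const (by norm_num)
  have hbn : ∀ᶠ n : ℕ in atTop, 2 / b ≤ n := tendsto_natCast_atTop_atTop.eventually_ge_atTop _
  filter_upwards [hBr, hbn, eventually_gt_atTop 0,
    tendsto_log_natCast.eventually_ge_atTop (12 / (a * b))] with n hBr hbn hn hlog
  have hn' : (0 : ℝ) < n := by exact_mod_cast hn
  rw [div_le_iff₀ hb] at hbn
  refine (measureReal_no_edge_between_le (hOut n) (hIn n) (b := 1 / 2)
    (fun y hy => (Finset.mem_filter.1 hy).2) (by norm_num) hBr (by linarith)).trans ?_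
  have h4 : (4 : ℝ) ^ n ≤ Real.exp (2 * n) := by
    have h5 : (4 : ℝ) ≤ Real.exp 2 := by
      have := Real.quadratic_le_exp_of_nonneg (show (0 : ℝ) ≤ 2 by norm_num)
      linarith
    refine (pow_le_pow_left₀ (by norm_num) h5 n).trans (le_of_eq ?_)
    rw [← Real.exp_nat_mul, mul_comm]
  refine (mul_le_mul_of_nonneg_right h4 (Real.exp_pos _).le).trans ?_
  rw [← Real.exp_add]
  refine Real.exp_le_exp.2 ?_
  have h6 : a * n * (b * n - 1) * (1 / 2 * (Real.log n / n)) =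
      a * (b * n - 1) * Real.log n / 2 := by field_simp
  rw [h6]
  rw [div_le_iff₀ (by positivity)] at hlog
  have hlog0 : 0 ≤ Real.log n := Real.log_natCast_nonneg n
  -- The exponent gained is at least `a b n log n / 4 ≥ 3 n`, against an entropy of at most `2 n`.
  have h7 : a * (b * n / 2) * Real.log n ≤ a * (b * n - 1) * Real.log n :=
    mul_le_mul_of_nonneg_right (mul_le_mul_of_nonneg_left (by linarith) ha.le) hlog0
  nlinarith

lemma tendsto_measureReal_large_degree (hM₁ : ∀ n x, wOut n x ≤ M₁) (hpos : ∀ n x, 0 < wOut n x)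
    (hIn : ∀ n x, 0 < wIn n x) (hsum : ∀ n, ∑ x, wOut n x = ∑ x, wIn n x) :
    Tendsto (fun n : ℕ => (law (wOut n) (wIn n)).real
      {ω | ∃ x, (2 * M₁ ^ 2 + 2) * Real.log n < ((outNbhd ω {x}).card : ℝ)}) atTop (𝓝 0) := by
  have hlim : Tendsto (fun n : ℕ => (n : ℝ) ^ (-1 : ℝ)) atTop (𝓝 0) :=
    tendsto_natCast_rpow_neg one_pos
  refine tendsto_of_tendsto_of_tendsto_of_le_of_le' tendsto_const_nhds hlim
    (Eventually.of_forall fun n => measureReal_nonneg) ?_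
  filter_upwards [eventually_gt_atTop 0] with n hn
  have hn' : (0 : ℝ) < n := by exact_mod_cast hn
  refine (measureReal_lt_card_outNbhd_le (hM₁ n) (hpos n) (hIn n) (hsum n) hn _).trans
    (le_of_eq ?_)
  rw [show 2 * M₁ ^ 2 * Real.log n - (2 * M₁ ^ 2 + 2) * Real.log n = Real.log n * (-2) by ring,
    ← Real.rpow_def_of_pos hn', show (-1 : ℝ) = 1 + -2 by norm_num, Real.rpow_add hn',
    Real.rpow_one]

lemma tendsto_measureReal_sum_sq_gt (hM₁ : ∀ n x, wOut n x ≤ M₁) (hpos : ∀ n x, 0 < wOut n x)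
    (hIn : ∀ n x, 0 < wIn n x) (hC : 0 < C) (hM₁0 : 0 < M₁)
    (hsq : ∀ n : ℕ, ∑ x, wIn n x ^ 2 ≤ C * n) {c : ℝ} (hc : 0 < c) {t : ℕ → ℕ} {a : ℝ}
    (ht : ∀ᶠ n in atTop, 1 ≤ t n)
    (hlim : Tendsto (fun n : ℕ => (t n : ℝ) ^ 2 * (n : ℝ) ^ (-a)) atTop (𝓝 0)) :
    Tendsto (fun n : ℕ => (law (wOut n) (wIn n)).real
      {ω | (n : ℝ) ^ (-1 + a) ≤ ∑ z, Matrix.vecMul (fun _ : Fin n => 1 / (n : ℝ))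
        (truncTransition (c * Real.log n) ω ^ t n) z ^ 2}) atTop (𝓝 0) := by
  set C₂ := 2 + 2 * C
  set C' := M₁ / c
  have hlim' := hlim.const_mul (C₂ * (1 + 4 * C' + 3 * C' ^ 2))
  rw [mul_zero] at hlim'
  refine tendsto_of_tendsto_of_tendsto_of_le_of_le' tendsto_const_nhds hlim'
    (Eventually.of_forall fun n => measureReal_nonneg) ?_
  filter_upwards [eventually_gt_atTop 0, ht, tendsto_log_natCast.eventually_gt_atTop 0]
    with n hn ht hlog
  have hn' : (0 : ℝ) < n := by exact_mod_cast hn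
  rw [law_eq_bernoulliPi]
  refine (measureReal_le_integral_div _ (fun ω => Finset.sum_nonneg fun z _ => sq_nonneg _)
    (Real.rpow_pos_of_pos hn' _)).trans ?_
  have hμ : (fun _ : Fin n => 1 / (n : ℝ)) ∈ stdSimplex ℝ (Fin n) := by
    refine ⟨fun _ => by positivity, ?_⟩
    simp only [Finset.sum_const, Finset.card_univ, Fintype.card_fin, nsmul_eq_mul]
    field_simp
  -- The collision estimate needs `v ≥ 1`, hence `v = 1 + wIn` in place of `wIn`.
  have hv2 : ∑ x, (1 + wIn n x) ^ 2 ≤ C₂ * n := by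
    have h1 : ∀ x, (1 + wIn n x) ^ 2 ≤ 2 + 2 * wIn n x ^ 2 := fun x => by
      nlinarith [sq_nonneg (1 - wIn n x)]
    refine (Finset.sum_le_sum fun x _ => h1 x).trans ?_
    rw [Finset.sum_add_distrib, ← Finset.mul_sum]
    simp only [Finset.sum_const, Finset.card_univ, Fintype.card_fin, nsmul_eq_mul]
    have := hsq n
    show _ ≤ (2 + 2 * C) * n
    linarith
  have key := integral_sum_sq_vecMul_pow_le (Q := truncTransition (n := n) (c * Real.log n))
    (dependsOn_truncTransition (c * Real.log n)) (fun e => edgeProb (wOut n) (wIn n) e.1 e.2)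
    (truncTransition_nonneg _) (sum_truncTransition_le_one _) (v := fun x => 1 + wIn n x)
    (C := C') (C₂ := C₂) (N := n)
    (fun x => by linarith [hIn n x]) hn' (by positivity) (by positivity) hv2
    (fun x y => by
      refine (integral_truncTransition_le (hM₁ n) (hpos n) (hIn n) (by positivity) x y).trans ?_
      have h1 : M₁ * wIn n y * (Real.log n / n) / (c * Real.log n) = C' * wIn n y / n := by
        simp only [C']; field_simp
      rw [h1]
      refine div_le_div_of_nonneg_right (mul_le_mul_of_nonneg_left ?_ (by positivity)) hn'.le
      linarith)
    hμ (fun _ => le_rfl) ht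
  refine (div_le_div_of_nonneg_right key (Real.rpow_pos_of_pos hn' _).le).trans (le_of_eq ?_)
  rw [Real.rpow_add hn', Real.rpow_neg hn'.le a, Real.rpow_neg_one]
  field_simp

end Asymptotics

/-- Expansion, connectivity of linear sets and bounded degrees, together with an `ℓ²` bound on
the law of the walk started from the uniform distribution, control the stationary distribution. -/
lemma mem_smallSetsEvent {n : ℕ} {ω : Fin n × Fin n → Bool} (hn : 0 < n) {g m Δ β α δ : ℝ}
    (hg : 1 ≤ g) (hm : 1 ≤ m)
    (hexp : ∀ A : Finset (Fin n), A.Nonempty → (A.card : ℝ) ≤ m →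
      g * A.card ≤ (outNbhd ω A).card)
    (hΔ : ∀ x, ((outNbhd ω {x}).card : ℝ) ≤ Δ) {F : Finset (Fin n)}
    (hbig : ∀ A B : Finset (Fin n), B ⊆ F → g * (m / 2) ≤ A.card → β ≤ B.card →
      ∃ x ∈ A, ∃ y ∈ B, ω (x, y) = true)
    {k J : ℕ} (hk : g * (m / 2) ≤ g ^ k) (hα0 : 0 < α) (hα1 : α ≤ 1)
    (hα : α ≤ (F.card - 2 * β) * (1 / Δ) ^ (k + 1))
    (hsq : ∑ z, Matrix.vecMul (fun _ : Fin n => 1 / (n : ℝ))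
      (truncTransition g ω ^ ((k + 1) * J)) z ^ 2 ≤ (n : ℝ) ^ (-1 + 2 * δ))
    (hsmall : (n : ℝ) ^ (-2 * δ) + (1 - α) ^ J ≤ (n : ℝ) ^ (-δ / 2)) :
    ω ∈ smallSetsEvent n δ := by
  have hn' : (0 : ℝ) < n := by exact_mod_cast hn
  have : Nonempty (Fin n) := ⟨⟨0, hn⟩⟩
  have hdeg : ∀ x, g ≤ (outNbhd ω {x}).card := fun x => by
    simpa using hexp {x} (Finset.singleton_nonempty x) (by simpa using hm)
  have hpos : ∀ x, 0 < (outNbhd ω {x}).card := fun x => by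
    have : (0 : ℝ) < (outNbhd ω {x}).card := by linarith [hdeg x]
    exact_mod_cast this
  have hM := transition_graph_mem_rowStochastic ω hpos
  have hover : ∀ x y, α ≤ ∑ z, min ((transition (graph ω) ^ (k + 1)) x z)
      ((transition (graph ω) ^ (k + 1)) y z) := fun x y =>
    hα.trans (le_sum_min_transition_pow hg hm hexp hΔ hpos hbig hk x y)
  rw [truncTransition_eq hdeg] at hsq
  obtain ⟨μ, hμ, hst⟩ := exists_stationary hM
  refine ⟨μ, ⟨hμ, hst⟩, fun ν hν => stationary_unique hM hα0 hα1 hover hν.1 hν.2 hμ hst,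
    fun S hS => ?_⟩
  have hunif : (fun _ : Fin n => 1 / (n : ℝ)) ∈ stdSimplex ℝ (Fin n) := by
    refine ⟨fun _ => by positivity, ?_⟩
    simp only [Finset.sum_const, Finset.card_univ, Fintype.card_fin, nsmul_eq_mul]
    field_simp
  refine (stationary_sum_le hM hα1 hover hμ hst hunif S J).trans (le_trans ?_ hsmall)
  -- Cauchy–Schwarz: `n ^ (1 - 6δ) * n ^ (-1 + 2δ)` is the square of `n ^ (-2δ)`.
  refine add_le_add_left ((sum_le_sqrt_card_mul S _).trans ?_) _
  rw [Real.sqrt_le_left (by positivity)]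
  refine (mul_le_mul hS hsq (Finset.sum_nonneg fun _ _ => sq_nonneg _) (by positivity)).trans
    (le_of_eq ?_)
  rw [← Real.rpow_add hn', ← Real.rpow_natCast, ← Real.rpow_mul hn'.le]
  congr 1
  push_cast; ring

/-! ### Choice of the time scales -/

section Parameters

/-- The number of generations after which the descendants of a vertex fill the digraph, when each
generation grows by a factor `c log n`. -/
noncomputable def growthTime (c : ℝ) (n : ℕ) : ℕ :=
  ⌈Real.log n / Real.log (c * Real.log n)⌉₊ + 1

variable {c : ℝ}

lemma tendsto_mul_log_natCast (hc : 0 < c) :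
    Tendsto (fun n : ℕ => c * Real.log n) atTop atTop :=
  tendsto_log_natCast.const_mul_atTop hc

lemma eventually_mul_le_pow_growthTime (hc : 0 < c) (a : ℝ) :
    ∀ᶠ n : ℕ in atTop, a * n ≤ (c * Real.log n) ^ growthTime c n := by
  filter_upwards [eventually_gt_atTop 0, (tendsto_mul_log_natCast hc).eventually_gt_atTop 1,
    (tendsto_mul_log_natCast hc).eventually_ge_atTop a] with n hn hg1 hga
  have hn' : (0 : ℝ) < n := by exact_mod_cast hn
  set g := c * Real.log n with hg
  have hlog : 0 < Real.log g := Real.log_pos hg1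
  have hg0 : 0 < g := by linarith
  have h1 : (n : ℝ) ≤ g ^ ⌈Real.log n / Real.log g⌉₊ := by
    rw [← Real.rpow_natCast]
    refine le_trans (le_of_eq ?_) (Real.rpow_le_rpow_of_exponent_le hg1.le (Nat.le_ceil _))
    rw [Real.rpow_def_of_pos hg0, mul_div_cancel₀ _ hlog.ne', Real.exp_log hn']
  -- The extra generation in `growthTime` supplies a factor `g ≥ a`.
  rw [growthTime, pow_succ']
  exact (mul_le_mul_of_nonneg_right hga hn'.le).trans (mul_le_mul_of_nonneg_left h1 hg0.le)

/-- Since `log (D log n) / log (c log n) → 1`, the power `(D log n) ^ (growthTime c n + 1)` is `n ^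
(1 + o(1))`. The allowance `ε log n` is split in three: the ratio of logarithms, at most three steps
of rounding (hence `ε / 9`), and the constant `a`. -/
lemma eventually_rpow_neg_le (hc : 0 < c) {D a ε : ℝ} (hD : 0 < D) (ha : 0 < a) (hε : 0 < ε) :
    ∀ᶠ n : ℕ in atTop,
      (n : ℝ) ^ (-ε) ≤ a * n * (1 / (D * Real.log n)) ^ (growthTime c n + 1) := by
  have hu : Tendsto (fun n : ℕ => Real.log (c * Real.log n)) atTop atTop :=
    Real.tendsto_log_atTop.comp (tendsto_mul_log_natCast hc)
  have hlo : ∀ᶠ n : ℕ in atTop,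
      Real.log (D * Real.log n) ≤ ε / 9 * Real.log n := by
    have h1 : Tendsto (fun n : ℕ => Real.log (D * Real.log n) / (D * Real.log n)) atTop (𝓝 0) :=
      (Real.isLittleO_log_id_atTop.tendsto_div_nhds_zero).comp (tendsto_mul_log_natCast hD)
    filter_upwards [h1.eventually_le_const (show 0 < ε / 9 / D by positivity),
      tendsto_log_natCast.eventually_gt_atTop 0] with n h hlog
    rw [div_le_iff₀ (by positivity)] at h
    refine h.trans (le_of_eq ?_)
    field_simp
  filter_upwards [eventually_gt_atTop 0, hu.eventually_gt_atTop 0,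
    hu.eventually_ge_atTop (3 * (Real.log D - Real.log c) / ε), hlo,
    tendsto_log_natCast.eventually_ge_atTop (-Real.log a / (ε / 3)),
    tendsto_log_natCast.eventually_gt_atTop 0,
    (tendsto_mul_log_natCast hD).eventually_ge_atTop 1]
    with n hn hu0 hu hlo hla hlog hD1
  have hn' : (0 : ℝ) < n := by exact_mod_cast hn
  set L := Real.log n with hL
  set u := Real.log (c * L) with hudef
  set v := Real.log (D * L) with hvdef
  have hv0 : 0 ≤ v := Real.log_nonneg hD1
  have huv : v = u + (Real.log D - Real.log c) := by
    rw [hudef, hvdef, Real.log_mul hD.ne' hlog.ne', Real.log_mul hc.ne' hlog.ne']; ring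
  have hs : ((growthTime c n + 1 : ℕ) : ℝ) ≤ L / u + 3 := by
    have := (Nat.ceil_lt_add_one (div_nonneg hlog.le hu0.le)).le
    rw [growthTime]
    push_cast
    linarith
  have h1 : ((growthTime c n + 1 : ℕ) : ℝ) * v ≤ L + Real.log a + ε * L := by
    refine (mul_le_mul_of_nonneg_right hs hv0).trans ?_
    have h2 : L / u * v ≤ L + ε / 3 * L := by
      rw [div_le_iff₀ hε] at hu
      rw [div_mul_eq_mul_div, div_le_iff₀ hu0, huv]
      nlinarith
    rw [div_le_iff₀ (by positivity)] at hla
    nlinarith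
  have h3 : a * n * (1 / (D * L)) ^ (growthTime c n + 1) =
      Real.exp (Real.log a + L - ((growthTime c n + 1 : ℕ) : ℝ) * v) := by
    rw [Real.exp_sub, Real.exp_add, Real.exp_log ha, Real.exp_log hn', Real.exp_nat_mul,
      Real.exp_log (by linarith), one_div, inv_pow]
    rfl
  rw [h3, Real.rpow_def_of_pos hn']
  refine Real.exp_le_exp.2 ?_
  linarith

lemma eventually_growthTime_le (hc : 0 < c) :
    ∀ᶠ n : ℕ in atTop, ((growthTime c n + 1 : ℕ) : ℝ) ≤ 4 * Real.log n := by
  have hu : Tendsto (fun n : ℕ => Real.log (c * Real.log n)) atTop atTop :=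
    Real.tendsto_log_atTop.comp (tendsto_mul_log_natCast hc)
  filter_upwards [hu.eventually_ge_atTop 1, tendsto_log_natCast.eventually_ge_atTop 1]
    with n hu hlog
  have h1 : Real.log n / Real.log (c * Real.log n) ≤ Real.log n := div_le_self (by linarith) hu
  have h2 := (Nat.ceil_lt_add_one
    (show 0 ≤ Real.log n / Real.log (c * Real.log n) by positivity)).le
  rw [growthTime]
  push_cast
  linarith

/-- The total time is at most `8 n ^ (δ / 2) log n`, so its square is `n ^ δ` up to logarithms, well
below `n ^ (2δ)`. -/
lemma tendsto_sq_time (hc : 0 < c) {δ : ℝ} (hδ : 0 < δ) :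
    Tendsto (fun n : ℕ => (((growthTime c n + 1) * ⌈(n : ℝ) ^ (δ / 2)⌉₊ : ℕ) : ℝ) ^ 2 *
      (n : ℝ) ^ (-(2 * δ))) atTop (𝓝 0) := by
  have hlim : Tendsto (fun n : ℕ => 64 * (Real.log n / (n : ℝ) ^ (δ / 2)) ^ 2) atTop (𝓝 0) := by
    have h1 : Tendsto (fun n : ℕ => Real.log n / (n : ℝ) ^ (δ / 2)) atTop (𝓝 0) :=
      ((isLittleO_log_rpow_atTop (by positivity)).tendsto_div_nhds_zero).comp
        tendsto_natCast_atTop_atTop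
    simpa using (h1.pow 2).const_mul 64
  refine tendsto_of_tendsto_of_tendsto_of_le_of_le' tendsto_const_nhds hlim
    (Eventually.of_forall fun n => by positivity) ?_
  filter_upwards [eventually_gt_atTop 0, eventually_growthTime_le hc] with n hn hs
  have hn1 : (1 : ℝ) ≤ n := by exact_mod_cast hn
  have hn' : (0 : ℝ) < n := by linarith
  set X := (n : ℝ) ^ (δ / 2) with hX
  have hX1 : 1 ≤ X := Real.one_le_rpow hn1 (by positivity)
  have hJ : (⌈X⌉₊ : ℝ) ≤ 2 * X := by
    linarith [(Nat.ceil_lt_add_one (show 0 ≤ X by linarith)).le]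
  have hneg : (n : ℝ) ^ (-(2 * δ)) = (X ^ 4)⁻¹ := by
    rw [Real.rpow_neg hn'.le, hX, ← Real.rpow_natCast, ← Real.rpow_mul hn'.le]
    congr 2
    push_cast; ring
  have hlog0 : 0 ≤ Real.log n := Real.log_natCast_nonneg n
  have ht : (((growthTime c n + 1) * ⌈X⌉₊ : ℕ) : ℝ) ≤ 4 * Real.log n * (2 * X) := by
    rw [Nat.cast_mul]
    exact mul_le_mul hs hJ (Nat.cast_nonneg _) (by positivity)
  rw [hneg]
  refine (mul_le_mul_of_nonneg_right (pow_le_pow_left₀ (Nat.cast_nonneg _) ht 2)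
    (by positivity)).trans (le_of_eq ?_)
  field_simp
  ring

/-- The contraction term is at most `exp (-y)` with `y = n ^ (δ / 4)`, and `y² exp (-y) ≤ 1 / 2`
eventually. Each summand is thus at most half of `n ^ (-δ / 2) = y ^ (-2)`. -/
lemma eventually_rpow_add_pow_le {δ : ℝ} (hδ : 0 < δ) :
    ∀ᶠ n : ℕ in atTop, (n : ℝ) ^ (-2 * δ) +
      (1 - (n : ℝ) ^ (-(δ / 4))) ^ ⌈(n : ℝ) ^ (δ / 2)⌉₊ ≤ (n : ℝ) ^ (-δ / 2) := by
  have h1 : Tendsto (fun n : ℕ => (n : ℝ) ^ (-(3 * δ / 2))) atTop (𝓝 0) :=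
    tendsto_natCast_rpow_neg (by positivity)
  have h2 : Tendsto (fun n : ℕ => (n : ℝ) ^ (δ / 4)) atTop atTop :=
    (tendsto_rpow_atTop (by positivity)).comp tendsto_natCast_atTop_atTop
  have h3 := (tendsto_rpow_mul_exp_neg_mul_atTop_nhds_zero 2 1 one_pos).comp h2
  filter_upwards [eventually_gt_atTop 0,
    h1.eventually_le_const (show (0 : ℝ) < 1 / 2 by norm_num),
    h3.eventually_le_const (show (0 : ℝ) < 1 / 2 by norm_num)] with n hn h1 h3
  have hn1 : (1 : ℝ) ≤ n := by exact_mod_cast hn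
  have hn' : (0 : ℝ) < n := by linarith
  have hY0 : 0 < (n : ℝ) ^ (-δ / 2) := by positivity
  simp only [Function.comp_apply] at h3
  rw [← Real.rpow_mul hn'.le] at h3
  have e1 : (n : ℝ) ^ (-2 * δ) = (n : ℝ) ^ (-δ / 2) * (n : ℝ) ^ (-(3 * δ / 2)) := by
    rw [← Real.rpow_add hn']; congr 1; ring
  have hα1 : (n : ℝ) ^ (-(δ / 4)) ≤ 1 := Real.rpow_le_one_of_one_le_of_nonpos hn1 (by linarith)
  have e2 : (1 - (n : ℝ) ^ (-(δ / 4))) ^ ⌈(n : ℝ) ^ (δ / 2)⌉₊ ≤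
      Real.exp (-1 * (n : ℝ) ^ (δ / 4)) := by
    have h5 := Real.add_one_le_exp (-(n : ℝ) ^ (-(δ / 4)))
    refine (pow_le_pow_left₀ (by linarith) (show 1 - (n : ℝ) ^ (-(δ / 4)) ≤
      Real.exp (-(n : ℝ) ^ (-(δ / 4))) by linarith) _).trans ?_
    rw [← Real.exp_nat_mul]
    refine Real.exp_le_exp.2 ?_
    have h6 := mul_le_mul_of_nonneg_right (Nat.le_ceil ((n : ℝ) ^ (δ / 2)))
      (show 0 ≤ (n : ℝ) ^ (-(δ / 4)) by positivity)
    rw [← Real.rpow_add hn', show δ / 2 + -(δ / 4) = δ / 4 by ring] at h6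
    linarith
  have e3 : Real.exp (-1 * (n : ℝ) ^ (δ / 4)) =
      (n : ℝ) ^ (-δ / 2) * ((n : ℝ) ^ (δ / 4 * 2) * Real.exp (-1 * (n : ℝ) ^ (δ / 4))) := by
    rw [← mul_assoc, ← Real.rpow_add hn', show -δ / 2 + δ / 4 * 2 = 0 by ring, Real.rpow_zero,
      one_mul]
  rw [e1]
  nlinarith

end Parameters

end ChungLu

/-! ### The main theorem -/

open ChungLu in
theorem lemma5p6 (wOut wIn : (n : ℕ) → Fin n → ℝ) (M₀ M₁ M₂ η δ : ℝ)
    (hOut_pos : ∀ n x, 0 < wOut n x) (hIn_pos : ∀ n x, 0 < wIn n x)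
    (hsum : ∀ n, ∑ x, wOut n x = ∑ x, wIn n x)
    (hM₀ : 1 < M₀) (hM₁ : 1 < M₁) (hM₂ : 0 < M₂) (hη₀ : 0 < η) (hη₁ : η < 1)
    (hOut : ∀ n x, M₀ ≤ wOut n x ∧ wOut n x ≤ M₁)
    (hIn : ∀ n, ∑ x, (wIn n x) ^ (2 + η) ≤ M₂ * n)
    (hδ₀ : 0 < δ) (hδ₁ : δ < η / 6) :
    Tendsto (fun n : ℕ => ChungLu.law (wOut n) (wIn n) (ChungLu.smallSetsEvent n δ))
      atTop (𝓝 1) := by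
  have hC : 0 < 1 + M₂ := by linarith
  have hsq := fun n => sum_sq_le_of_sum_rpow_le (hIn_pos n) hη₀ (hIn n)
  have hOut1 : ∀ n x, 1 ≤ wOut n x := fun n x => hM₀.le.trans (hOut n x).1
  have hmass : ∀ n : ℕ, M₀ * n ≤ ∑ x, wIn n x := fun n => by
    rw [← hsum, mul_comm, ← nsmul_eq_mul]
    simpa using Finset.card_nsmul_le_sum Finset.univ (wOut n) M₀ fun x _ => (hOut n x).1
  obtain ⟨κ, c, hκ, hc, hexp⟩ :=
    tendsto_measureReal_not_expanding hOut1 hIn_pos hM₀ hmass hC hsq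
  set D := 2 * M₁ ^ 2 + 2 with hD
  have hD0 : 0 < D := by positivity
  -- At least `n / (4 (1 + M₂))` vertices have in-weight at least `1 / 2`. Losing `b n` of them for
  -- each of two starting points leaves half.
  set b := 1 / (16 * (1 + M₂)) with hb
  have hb0 : 0 < b := by positivity
  have hbig := tendsto_measureReal_no_edge_between hOut1 hIn_pos
    (show 0 < c * κ / 2 by positivity) hb0
  have hdeg := tendsto_measureReal_large_degree (fun n x => (hOut n x).2) hOut_pos hIn_pos hsum
  have hl2 := tendsto_measureReal_sum_sq_gt (fun n x => (hOut n x).2) hOut_pos hIn_pos hC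
    (by linarith) hsq hc (t := fun n => (growthTime c n + 1) * ⌈(n : ℝ) ^ (δ / 2)⌉₊) (a := 2 * δ)
    (by
      filter_upwards [eventually_gt_atTop 0] with n hn
      have hn' : (0 : ℝ) < n := by exact_mod_cast hn
      exact Nat.mul_pos (Nat.succ_pos _) (Nat.ceil_pos.2 (by positivity)))
    (tendsto_sq_time hc hδ₀)
  have hbad := ((hexp.add hbig).add hdeg).add hl2
  simp only [add_zero] at hbad
  have hreal : Tendsto (fun n : ℕ => (law (wOut n) (wIn n)).real (smallSetsEvent n δ))
      atTop (𝓝 1) := by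
    have hlow := hbad.const_sub 1
    rw [sub_zero] at hlow
    refine tendsto_of_tendsto_of_tendsto_of_le_of_le' hlow tendsto_const_nhds ?_
      (Eventually.of_forall fun n => measureReal_le_one)
    filter_upwards [eventually_gt_atTop 0, tendsto_log_natCast.eventually_gt_atTop 0,
      (tendsto_mul_log_natCast hc).eventually_ge_atTop 1,
      tendsto_log_div_natCast.eventually_le_const hκ,
      eventually_mul_le_pow_growthTime hc (c * κ / 2),
      eventually_rpow_neg_le hc hD0 (show 0 < 1 / (8 * (1 + M₂)) by positivity)
        (show 0 < δ / 4 by positivity),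
      eventually_rpow_add_pow_le hδ₀] with n hn hlog hg hmn hk hα hsmall
    have hn1 : (1 : ℝ) ≤ n := by exact_mod_cast hn
    have hn' : (0 : ℝ) < n := by linarith
    have hgm : c * Real.log n * (κ * n / Real.log n / 2) = c * κ / 2 * n := by field_simp
    have hm : 1 ≤ κ * n / Real.log n := by
      rw [le_div_iff₀ hlog, one_mul]
      rwa [div_le_iff₀ hn'] at hmn
    have hF := le_card_filter_half_le (hIn_pos n) hC
      ((le_mul_of_one_le_left hn'.le hM₀.le).trans (hmass n)) (hsq n)
    set F := Finset.univ.filter fun y => 1 / 2 ≤ wIn n y with hFdef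
    rw [sub_le_comm, ← probReal_compl_eq_one_sub (measurableSet_config _)]
    refine le_trans (measureReal_mono ?_ (measure_ne_top _ _)) ((measureReal_union_le _ _).trans
      (add_le_add_left ((measureReal_union_le _ _).trans
        (add_le_add_left (measureReal_union_le _ _) _)) _))
    intro ω hω
    by_contra hgood
    refine hω ?_
    simp only [Set.mem_union, Set.mem_ofPred_eq, not_or] at hgood
    obtain ⟨⟨⟨h1, h2⟩, h3⟩, h4⟩ := hgood
    push Not at h1 h2 h3 h4
    refine mem_smallSetsEvent hn hg hm (fun A hA hAm => h1 A hA hAm) h3 (F := F) (β := b * n)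
      (fun A B hB hA hBb => ?_) (k := growthTime c n) (J := ⌈(n : ℝ) ^ (δ / 2)⌉₊) (by rwa [hgm])
      (α := (n : ℝ) ^ (-(δ / 4))) (by positivity)
      (Real.rpow_le_one_of_one_le_of_nonpos hn1 (by linarith)) ?_ h4.le hsmall
    · rw [hgm] at hA
      obtain ⟨x, hx, y, hy, hxy⟩ := h2 A B hB hA hBb
      exact ⟨x, hx, y, hy, by simpa using hxy⟩
    · refine hα.trans (mul_le_mul_of_nonneg_right ?_ (by positivity))
      have : 1 / (8 * (1 + M₂)) * n = n / (4 * (1 + M₂)) - 2 * (b * n) := by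
        rw [hb]; field_simp; norm_num
      rw [this]
      linarith
  have := ENNReal.tendsto_ofReal hreal
  simpa [ofReal_measureReal] using this
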